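/- An election consists of a finite set $C$ of candidates and a finite collection of voters, each of whom casts a vote that is a total order of $C$ (different voters may cast the same vote). Under the voting rule First-Last every voter gives $1$ point to the candidate ranked first, $-1$ point to the candidate ranked last and $0$ points to all others (scoring vector $\langle 1,0,\dots,0,-1\rangle$), and the candidates with the highest total score are the winners. First-Last-CCAV! (exact constructive control by adding voters) is the decision problem: given an election $(C,V)$, a collection $W$ of unregistered voters over $C$, an integer $k\ge 0$ and a preferred candidate $p\in C$, does there exist $W'\subseteq W$ with exactly $k$ voters such that $p$ is a First-Last winner of $(C,V\cup W')$? Exact Perfect Bipartite Matching is the decision problem: given a finite (simple) bipartite graph $G=(A\cup B,E)$ with parts $A$ and $B$, a set $R\subseteq E$ of red edges and an integer $k\ge 0$, does there exist a set $M\subseteq E$, exactly $k$ of whose edges are red, such that every vertex of $G$ is incident with exactly one edge in $M$? Instances are encoded as strings over a finite alphabet in the usual way: candidates, vertices, votes and edges are listed explicitly, and numbers are written in binary. A polynomial-time disjunctive truth-table (dtt) reduction from a decision problem $X$ to a decision problem $Y$ is a function, computable by a Turing machine in time polynomial in the length of the encoded input, that maps every instance $x$ of $X$ to a finite (possibly empty)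 list of instances of $Y$ such that $x$ is a yes-instance of $X$ if and only if at least one member of the list is a yes-instance of $Y$. **Theorem.** First-Last-CCAV! and Exact Perfect Bipartite Matching are polynomial-time dtt equivalent: there is a polynomial-time dtt reduction from First-Last-CCAV! to Exact Perfect Bipartite Matching, and there is a polynomial-time dtt reduction from Exact Perfect Bipartite Matching to First-Last-CCAV!. -/

import Mathlib

namespace VoteControl

open Computability

/-! ### Encodings of instances as strings

Strings are over Mathlib's finite alphabet `Computability.Γ'`
(bits, the two brackets, the comma, and a blank that is not used here). -/

/-- An encoding of `α` by strings such that a string can be split in at most one way into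
the code of an object and a remainder. In particular the encoding is injective, and so are
the encodings of pairs and of lists that are built from it by concatenation. -/
structure Code (α : Type) where
  encode : α → List Γ'
  unique : ∀ x y s t, encode x ++ s = encode y ++ t → x = y ∧ s = t

/-- The code of a bit. -/
def Code.bool : Code Bool where
  encode b := [Γ'.bit b]
  unique x y s t h := by simpa using h

theorem map_bit_comma_unique (l₁ l₂ : List Bool) (s t : List Γ')
    (h : l₁.map Γ'.bit ++ Γ'.comma :: s = l₂.map Γ'.bit ++ Γ'.comma :: t) :
    l₁ = l₂ ∧ s = t := by
  induction l₁ generalizing l₂ with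
  | nil => cases l₂ <;> simp_all
  | cons a l ih =>
    cases l₂ with
    | nil => simp at h
    | cons b l' =>
      simp only [List.map_cons, List.cons_append, List.cons.injEq, Γ'.bit.injEq] at h
      obtain ⟨h1, h2⟩ := ih l' h.2
      exact ⟨by rw [h.1, h1], h2⟩

/-- Natural numbers are written in binary, least significant bit first, followed by a comma. -/
def Code.nat : Code ℕ where
  encode n := (encodeNat n).map Γ'.bit ++ [Γ'.comma]
  unique x y s t h := by
    simp only [List.append_assoc, List.singleton_append] at h
    obtain ⟨h1, h2⟩ := map_bit_comma_unique _ _ _ _ h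
    exact ⟨by rw [← decode_encodeNat x, h1, decode_encodeNat], h2⟩

/-- The code of a pair is the concatenation of the codes of its components. -/
def Code.pair {α β : Type} (a : Code α) (b : Code β) : Code (α × β) where
  encode x := a.encode x.1 ++ b.encode x.2
  unique x y s t h := by
    simp only [List.append_assoc] at h
    obtain ⟨h1, h2⟩ := a.unique _ _ _ _ h
    obtain ⟨h3, h4⟩ := b.unique _ _ _ _ h2
    exact ⟨Prod.ext h1 h3, h4⟩

/-- A bracketed list: each item is announced by an opening bracket, and a closing bracket
ends the list. -/
def encodeList {α : Type} (e : α → List Γ') (l : List α) : List Γ' :=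
  l.flatMap (fun x => Γ'.bra :: e x) ++ [Γ'.ket]

def Code.list {α : Type} (a : Code α) : Code (List α) where
  encode := encodeList a.encode
  unique x y s t h := by
    induction x generalizing y with
    | nil => cases y <;> simp_all [encodeList]
    | cons u x ih =>
      cases y with
      | nil => simp [encodeList] at h
      | cons v y =>
        simp only [encodeList, List.flatMap_cons, List.cons_append, List.append_assoc,
          List.cons.injEq, true_and] at h
        obtain ⟨h1, h2⟩ := a.unique _ _ _ _ h
        obtain ⟨h3, h4⟩ := ih y (by simpa [encodeList] using h2)
        exact ⟨by rw [h1, h3], h4⟩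

/-- The code of an object that is described by the data `g x`. -/
def Code.comap {α β : Type} (b : Code β) (g : α → β) (hg : Function.Injective g) : Code α where
  encode x := b.encode (g x)
  unique x y s t h := by
    obtain ⟨h1, h2⟩ := b.unique _ _ _ _ h
    exact ⟨hg h1, h2⟩

/-! ### Decision problems and polynomial-time disjunctive truth-table reductions -/

/-- A decision problem: instances, their encoding as strings, and the yes-instances. -/
structure DecisionProblem where
  Instance : Type
  code : Code Instance
  IsYes : Instance → Prop

/-- `X` disjunctively truth-table reduces to `Y` in polynomial time: some function, computable by
a (multi-stack) Turing machine in a number of steps that is polynomial in the length of the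
encoded input, maps every instance `x` of `X` to a list of instances of `Y` such that `x` is a
yes-instance if and only if at least one member of the list is. -/
def PolyTimeDTTReducible (X Y : DecisionProblem) : Prop :=
  ∃ f : X.Instance → List Y.Instance,
    Nonempty (Turing.TM2ComputableInPolyTime X.code.encode Y.code.list.encode f) ∧
      ∀ x, X.IsYes x ↔ ∃ y ∈ f x, Y.IsYes y

def PolyTimeDTTEquivalent (X Y : DecisionProblem) : Prop :=
  PolyTimeDTTReducible X Y ∧ PolyTimeDTTReducible Y X

/-! ### Elections, voting rules, and control by adding voters -/

/-- A total-order vote over the candidates `0, …, m - 1`: the candidate `v i` is ranked at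
position `i`, where position `0` is the top one. -/
abbrev Vote (m : ℕ) := Equiv.Perm (Fin m)

/-- A voting rule maps an election, given by `m` candidates and the list of the votes of the
voters, to the set of winners. -/
abbrev VotingRule := (m : ℕ) → List (Vote m) → Set (Fin m)

/-- The score of the candidate `c`: a voter who ranks `c` at position `i` gives `c` the `i`-th
entry of the scoring vector for `m` candidates. -/
def score (α : (m : ℕ) → Fin m → ℤ) {m : ℕ} (votes : List (Vote m)) (c : Fin m) : ℤ :=
  (votes.map fun v => α m (v.symm c)).sum

/-- The scoring rule of a family of scoring vectors: the candidates with the highest score win. -/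
def scoringRule (α : (m : ℕ) → Fin m → ℤ) : VotingRule :=
  fun _ votes => {c | ∀ d, score α votes d ≤ score α votes c}

/-- The scoring vectors `⟨1, 0, …, 0, -1⟩`. (For a single candidate the entry is `1 - 1 = 0`;
whatever its value, that candidate wins.) -/
def firstLastVector (m : ℕ) (i : Fin m) : ℤ :=
  (if (i : ℕ) = 0 then 1 else 0) - (if (i : ℕ) + 1 = m then 1 else 0)

def firstLast : VotingRule := scoringRule firstLastVector

/-- An instance of control by adding voters. Voters are the positions in the two lists, so that
different voters may cast the same vote. -/
structure AddingVotersInstance where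
  /-- the number of candidates -/
  m : ℕ
  /-- the preferred candidate -/
  p : Fin m
  /-- the number of voters to add -/
  k : ℕ
  /-- the votes of the registered voters -/
  registered : List (Vote m)
  /-- the votes of the unregistered voters -/
  unregistered : List (Vote m)

/-- A vote, written as the list of the candidates from first to last. -/
def Vote.toList {m : ℕ} (v : Vote m) : List ℕ :=
  List.ofFn fun i => (v i : ℕ)

theorem Vote.toList_injective (m : ℕ) :
    Function.Injective (Vote.toList : Vote m → List ℕ) := by
  intro v w h
  ext i
  exact congrFun (List.ofFn_injective h) i

/-- The data of an instance: the candidates, the preferred one, the number `k`, and the votes of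
the registered and of the unregistered voters. -/
def AddingVotersInstance.toData (I : AddingVotersInstance) :
    List ℕ × ℕ × ℕ × List (List ℕ) × List (List ℕ) :=
  (List.range I.m, I.p, I.k, I.registered.map Vote.toList, I.unregistered.map Vote.toList)

theorem AddingVotersInstance.toData_injective :
    Function.Injective AddingVotersInstance.toData := by
  rintro ⟨m, p, k, V, W⟩ ⟨m', p', k', V', W'⟩ h
  simp only [toData, Prod.mk.injEq] at h
  obtain ⟨h1, h2, h3, h4, h5⟩ := h
  obtain rfl : m = m' := by simpa using congrArg List.length h1
  have hi := (Vote.toList_injective m).list_map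
  obtain rfl := Fin.ext h2
  obtain rfl := hi h4
  obtain rfl := hi h5
  rw [h3]

def AddingVotersInstance.code : Code AddingVotersInstance :=
  (Code.nat.list.pair (Code.nat.pair (Code.nat.pair
    (Code.nat.list.list.pair Code.nat.list.list)))).comap toData toData_injective

/-- Exact constructive control by adding voters for the voting rule `rule`: can one add exactly
`k` of the unregistered voters such that `p` is a winner? -/
def exactCCAV (rule : VotingRule) : DecisionProblem where
  Instance := AddingVotersInstance
  code := AddingVotersInstance.code
  IsYes I := ∃ added : List (Vote I.m), added.Sublist I.unregistered ∧ added.length = I.k ∧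
    I.p ∈ rule I.m (I.registered ++ added)

/-! ### Exact perfect bipartite matching -/

/-- An instance of exact perfect bipartite matching: a bipartite graph with the parts
`0, …, left - 1` and `0, …, right - 1`, each edge of which is marked as red or not, and a number.
The triple `(u, v, c)` stands for the edge between `u` in the left and `v` in the right part,
which is red if `c = true`. -/
structure RedBipartiteInstance where
  left : ℕ
  right : ℕ
  k : ℕ
  edgeList : List (Fin left × Fin right × Bool)
  /-- no edge is listed twice -/
  nodup : (edgeList.map fun e => (e.1, e.2.1)).Nodup

namespace RedBipartiteInstance

/-- The set `E` of the edges. -/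
def edges (I : RedBipartiteInstance) : Finset (Fin I.left × Fin I.right) :=
  (I.edgeList.map fun e => (e.1, e.2.1)).toFinset

/-- The set `R ⊆ E` of the red edges. -/
def redEdges (I : RedBipartiteInstance) : Finset (Fin I.left × Fin I.right) :=
  ((I.edgeList.filter fun e => e.2.2).map fun e => (e.1, e.2.1)).toFinset

/-- `M` is a perfect matching: a set of edges such that every vertex is incident with exactly one
edge in `M`. -/
def IsPerfectMatching (I : RedBipartiteInstance) (M : Finset (Fin I.left × Fin I.right)) : Prop :=
  M ⊆ I.edges ∧ (∀ u, ∃! e, e ∈ M ∧ e.1 = u) ∧ (∀ v, ∃! e, e ∈ M ∧ e.2 = v)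

/-- The data of an instance: the vertices of the two parts, the number `k`, and the edges with
their marks. -/
def toData (I : RedBipartiteInstance) : List ℕ × List ℕ × ℕ × List (ℕ × ℕ × Bool) :=
  (List.range I.left, List.range I.right, I.k,
    I.edgeList.map fun e => ((e.1 : ℕ), (e.2.1 : ℕ), e.2.2))

theorem toData_injective : Function.Injective toData := by
  rintro ⟨a, b, k, E, hE⟩ ⟨a', b', k', E', hE'⟩ h
  simp only [toData, Prod.mk.injEq] at h
  obtain ⟨h1, h2, h3, h4⟩ := h
  obtain rfl : a = a' := by simpa using congrArg List.length h1
  obtain rfl : b = b' := by simpa using congrArg List.length h2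
  subst h3
  have hi : Function.Injective
      fun e : Fin a × Fin b × Bool => ((e.1 : ℕ), (e.2.1 : ℕ), e.2.2) := by
    rintro ⟨u, v, c⟩ ⟨u', v', c'⟩ h
    simp only [Prod.mk.injEq] at h
    obtain ⟨h1, h2, h3⟩ := h
    rw [Fin.ext h1, Fin.ext h2, h3]
  obtain rfl := hi.list_map h4
  rfl

def code : Code RedBipartiteInstance :=
  (Code.nat.list.pair (Code.nat.list.pair (Code.nat.pair
    (Code.nat.pair (Code.nat.pair Code.bool)).list))).comap toData toData_injective

end RedBipartiteInstance

/-- Exact Perfect Bipartite Matching: is there a perfect matching with exactly `k` red edges? -/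
def exactPerfectBipartiteMatching : DecisionProblem where
  Instance := RedBipartiteInstance
  code := RedBipartiteInstance.code
  IsYes I := ∃ M, I.IsPerfectMatching M ∧ (M ∩ I.redEdges).card = I.k

end VoteControl

open Computability

namespace VoteControl

/-! ### Structured programs on four stacks -/

/-! Under First-Last a voter moves one point from the last candidate of the vote to the first one.
So a voter is an arc, a score is a net inflow, and all scores add up to zero.

From control to matching, the winning score `s` of `p` is guessed. It is nonnegative, being a
maximum of numbers with sum zero, and at most the number of voters, so there is one graph for each
of polynomially many `s`; this is where a list of queries is needed. Let every voter support its
last candidate unless it is registered or added, in which case it supports its first one. The number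
of supporters of `c` minus the number of voters ranking `c` last is then the score of `c`
(`Flow.card_target`). In the graph for `s`, the candidate `c` owns one right vertex for each voter
ranking it last, and `s` more. On the left there are the voters and `s` fillers per candidate. A
registered voter is joined to the vertices of its first candidate, an unregistered one by red edges
to those of its first and by black edges to those of its last candidate, and a filler to all
vertices not owned by `p`. A perfect matching exists exactly if no candidate has more supporters
than vertices and `p` has equally many, that is, if all scores are at most `s` and `p` has score
`s`. The red edges count the added voters. See `Flow.exists_perm_iff` and `Flow.exists_total_iff`.

From matching to control, registered voters give each left vertex score 1 and each right vertex
score -1. A black edge becomes a voter that moves a point from its left to its right end; a red edge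
becomes a path of two such voters through a middle candidate. The preferred candidate is at neither
end of any vote, so it wins only if all scores vanish. That makes the chosen edges a perfect
matching and forces the two voters of a red edge to be chosen together. Hence the number of added
voters is the number of left vertices plus the number of red edges
(`RedBipartiteInstance.toElection_isYes`).

For the running time, structured programs on four stacks are compiled to Turing machines
(`Prog.Run.simulate`). They operate on binary trees, and `PolyTime` is closed under composition,
pairing, case distinction and folds of bounded size, so most functions are handled by `fun_prop`.
Indices and lengths are in unary; `k`, which may be exponential in the input length, stays a list of
bits. `Parsable` and `dttReducible_of_polyTime` link this to the string encodings. -/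

/-- The stacks of a structured program. -/
inductive Stk
  | main | left | right | count
  deriving DecidableEq

instance : Fintype Stk := ⟨{.main, .left, .right, .count}, fun k => by cases k <;> simp⟩

/-- The contents of the stacks. -/
abbrev Store := Stk → List Γ'

/-- Structured programs that operate on the stacks. -/
inductive Prog
  /-- push a symbol -/
  | push (k : Stk) (a : Γ')
  /-- discard the top symbol -/
  | pop (k : Stk)
  /-- move the top symbol of `k` to `l` -/
  | move (k l : Stk)
  /-- remove the top symbol of `k`, and push it onto `l₁` and `l₂` -/
  | fork (k l₁ l₂ : Stk)
  | seq (P Q : Prog)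
  | ite (k : Stk) (t : Option Γ' → Bool) (P Q : Prog)
  | whl (k : Stk) (t : Option Γ' → Bool) (P : Prog)

namespace Prog

open Function (update)

/-- Running a program from one store to another in a given number of steps. -/
inductive Run : Prog → Store → Store → ℕ → Prop
  | push (k a s) : Run (push k a) s (update s k (a :: s k)) 1
  | pop (k s) : Run (pop k) s (update s k (s k).tail) 1
  | move (k l : Stk) (s : Store) (a : Γ') (h : (s k).head? = some a) :
      Run (move k l) s
        (update (update s k (s k).tail) l (a :: update s k (s k).tail l)) 1
  | fork (k l₁ l₂ : Stk) (s : Store) (a : Γ') (h : (s k).head? = some a) (s₁ s₂ : Store)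
      (h₁ : s₁ = update (update s k (s k).tail) l₁ (a :: update s k (s k).tail l₁))
      (h₂ : s₂ = update s₁ l₂ (a :: s₁ l₂)) :
      Run (fork k l₁ l₂) s s₂ 1
  | seq {P Q s₁ s₂ s₃ m n} : Run P s₁ s₂ m → Run Q s₂ s₃ n → Run (seq P Q) s₁ s₃ (m + n)
  | ite_true {k t P Q s₁ s₂ n} (h : t (s₁ k).head? = true) :
      Run P s₁ s₂ n → Run (ite k t P Q) s₁ s₂ (n + 1)
  | ite_false {k t P Q s₁ s₂ n} (h : t (s₁ k).head? = false) :
      Run Q s₁ s₂ n → Run (ite k t P Q) s₁ s₂ (n + 1)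
  | whl_true {k t P s₁ s₂ s₃ m n} (h : t (s₁ k).head? = true) :
      Run P s₁ s₂ m → Run (whl k t P) s₂ s₃ n → Run (whl k t P) s₁ s₃ (m + n + 1)
  | whl_false {k t P s} (h : t (s k).head? = false) : Run (whl k t P) s s 1

/-! ### Compilation of structured programs -/

/-- The labels of the compiled program. -/
def Lab : Prog → Type
  | push _ _ => Unit
  | pop _ => Unit
  | move _ _ => Unit
  | fork _ _ _ => Unit
  | seq P Q => P.Lab ⊕ Q.Lab
  | ite _ _ P Q => Option (P.Lab ⊕ Q.Lab)
  | whl _ _ P => Option P.Lab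

theorem finite_lab : ∀ P : Prog, Finite P.Lab
  | push _ _ => inferInstanceAs (Finite Unit)
  | pop _ => inferInstanceAs (Finite Unit)
  | move _ _ => inferInstanceAs (Finite Unit)
  | fork _ _ _ => inferInstanceAs (Finite Unit)
  | seq P Q =>
    have := finite_lab P; have := finite_lab Q
    inferInstanceAs (Finite (P.Lab ⊕ Q.Lab))
  | ite _ _ P Q =>
    have := finite_lab P; have := finite_lab Q
    inferInstanceAs (Finite (Option (P.Lab ⊕ Q.Lab)))
  | whl _ _ P =>
    have := finite_lab P
    inferInstanceAs (Finite (Option P.Lab))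

/-- The label at which the compiled program starts. -/
def entry : ∀ P : Prog, P.Lab
  | push _ _ => ()
  | pop _ => ()
  | move _ _ => ()
  | fork _ _ _ => ()
  | seq P _ => Sum.inl P.entry
  | ite _ _ _ _ => none
  | whl _ _ _ => none

/-- The statements of the compiled program, where `e` embeds its labels into those of the whole
machine and `x` is the label to go to at the end. -/
def compile {Λ : Type} : ∀ P : Prog, (P.Lab → Λ) → Λ → P.Lab →
    Turing.TM2.Stmt (fun _ : Stk => Γ') Λ (Option Γ')
  | .push k a, _, x, _ => .push k (fun _ => a) (.goto fun _ => x)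
  | .pop k, _, x, _ => .pop k (fun v _ => v) (.goto fun _ => x)
  -- The default symbol is never pushed in a `Run`, which requires a top symbol on `k`.
  | .move k l, _, x, _ =>
    .pop k (fun _ a => a) (.push l (fun v => v.getD Γ'.blank) (.goto fun _ => x))
  | .fork k l₁ l₂, _, x, _ =>
    .pop k (fun _ a => a) (.push l₁ (fun v => v.getD Γ'.blank)
      (.push l₂ (fun v => v.getD Γ'.blank) (.goto fun _ => x)))
  | .seq P Q, e, _, .inl i => P.compile (fun j => e (.inl j)) (e (.inr Q.entry)) i
  | .seq _ Q, e, x, .inr i => Q.compile (fun j => e (.inr j)) x i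
  | .ite k t P Q, e, _, none =>
    .peek k (fun _ a => a) (.branch t (.goto fun _ => e (some (.inl P.entry)))
      (.goto fun _ => e (some (.inr Q.entry))))
  | .ite _ _ P _, e, x, some (.inl i) => P.compile (fun j => e (some (.inl j))) x i
  | .ite _ _ _ Q, e, x, some (.inr i) => Q.compile (fun j => e (some (.inr j))) x i
  | .whl k t P, e, x, none =>
    .peek k (fun _ a => a) (.branch t (.goto fun _ => e (some P.entry)) (.goto fun _ => x))
  | .whl _ _ P, e, _, some i => P.compile (fun j => e (some j)) (e none) i

/-- Glues consecutive stretches of a machine computation, with the lifted step function as `f`. -/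
theorem iterate_bind_add {α : Type*} (f : Option α → Option α) {a b c : Option α} {m n : ℕ}
    (h₁ : f^[m] a = b) (h₂ : f^[n] b = c) : f^[m + n] a = c := by
  rw [Nat.add_comm, Function.iterate_add_apply, h₁, h₂]

/-- A machine that contains the compiled program simulates it. -/
theorem Run.simulate {P : Prog} {s s' : Store} {n : ℕ} (h : P.Run s s' n) {Λ : Type}
    (M : Λ → Turing.TM2.Stmt (fun _ : Stk => Γ') Λ (Option Γ'))
    (e : P.Lab → Λ) (x : Λ) (hM : ∀ i, M (e i) = P.compile e x i) (v : Option Γ') :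
    ∃ v', (flip Option.bind (Turing.TM2.step M))^[n]
      (some ⟨some (e P.entry), v, s⟩) = some ⟨some x, v', s'⟩ := by
  induction h generalizing v x with
  | push k a s =>
    have h₀ := hM ()
    simp only [compile] at h₀
    exact ⟨v, by simp [flip, entry, h₀]⟩
  | pop k s =>
    have h₀ := hM ()
    simp only [compile] at h₀
    exact ⟨v, by simp [flip, entry, h₀]⟩
  | move k l s a h =>
    have h₀ := hM ()
    simp only [compile] at h₀
    exact ⟨some a, by simp [flip, entry, h₀, h]⟩
  | fork k l₁ l₂ s a h s₁ s₂ h₁ h₂ =>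
    subst h₁ h₂
    have h₀ := hM ()
    simp only [compile] at h₀
    exact ⟨some a, by simp [flip, entry, h₀, h]⟩
  | seq h₁ h₂ ih₁ ih₂ =>
    obtain ⟨v₁, hv₁⟩ := ih₁ _ _ (fun i => hM (.inl i)) v
    obtain ⟨v₂, hv₂⟩ := ih₂ _ _ (fun i => hM (.inr i)) v₁
    exact ⟨v₂, iterate_bind_add _ hv₁ hv₂⟩
  | ite_true h h₁ ih =>
    have h₀ := hM none
    simp only [compile] at h₀
    obtain ⟨v₁, hv₁⟩ := ih _ _ (fun i => hM (some (.inl i))) _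
    refine ⟨v₁, ?_⟩
    rw [Nat.add_comm]
    exact iterate_bind_add _ (by simp [flip, entry, h₀, h]; rfl) hv₁
  | ite_false h h₁ ih =>
    have h₀ := hM none
    simp only [compile] at h₀
    obtain ⟨v₁, hv₁⟩ := ih _ _ (fun i => hM (some (.inr i))) _
    refine ⟨v₁, ?_⟩
    rw [Nat.add_comm]
    exact iterate_bind_add _ (by simp [flip, entry, h₀, h]; rfl) hv₁
  | whl_true h h₁ h₂ ih₁ ih₂ =>
    have h₀ := hM none
    simp only [compile] at h₀
    obtain ⟨v₁, hv₁⟩ := ih₁ _ _ (fun i => hM (some i)) _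
    obtain ⟨v₂, hv₂⟩ := ih₂ _ _ hM v₁
    refine ⟨v₂, ?_⟩
    rw [Nat.add_comm]
    exact iterate_bind_add _ (by simp [flip, entry, h₀, h]; rfl)
      (iterate_bind_add _ hv₁ hv₂)
  | whl_false h =>
    have h₀ := hM none
    simp only [compile] at h₀
    exact ⟨_, by simp [flip, entry, h₀, h]; rfl⟩

/-- The machine that runs the program on the input in the main stack and leaves the output there. -/
noncomputable def machine (P : Prog) : Turing.FinTM2 :=
  have := P.finite_lab
  { K := Stk
    k₀ := .main
    k₁ := .main
    Γ := fun _ => Γ'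
    Λ := Option P.Lab
    main := some P.entry
    ΛFin := Fintype.ofFinite _
    σ := Option Γ'
    initialState := none
    -- A halting configuration must have the initial internal state, so the exit label resets it.
    -- This costs one additional step in `computableInPolyTime`.
    m := fun l => l.elim (.load (fun _ => none) .halt) (P.compile some none) }

/-- The store with the given contents of the four stacks. -/
def mk (m a b c : List Γ') : Store
  | .main => m
  | .left => a
  | .right => b
  | .count => c

theorem computableInPolyTime {α β : Type} {ea : α → List Γ'} {eb : β → List Γ'} {f : α → β}
    (P : Prog) (p : Polynomial ℕ)
    (h : ∀ x, ∃ n ≤ p.eval (ea x).length, P.Run (mk (ea x) [] [] []) (mk (eb (f x)) [] [] []) n) :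
    Nonempty (Turing.TM2ComputableInPolyTime ea eb f) := by
  choose n hn hr using h
  refine ⟨{ tm := P.machine, inputAlphabet := Equiv.refl _, outputAlphabet := Equiv.refl _,
            time := p + 1, outputsFun := fun x => ⟨⟨n x + 1, ?_⟩, ?_⟩ }⟩
  · obtain ⟨v, hv⟩ := (hr x).simulate P.machine.m some none (fun i => rfl) none
    refine iterate_bind_add _ (b := some ⟨some none, v, mk (eb (f x)) [] [] []⟩) ?_ ?_
    · refine Eq.trans ?_ hv
      congr 2
      simp only [Turing.initList]
      congr 1
      funext k
      cases k
      · simp only [machine, mk, Equiv.invFun_as_coe, Equiv.refl_symm, Equiv.coe_refl, List.map_id]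
        rfl
      all_goals rfl
    · simp only [Turing.haltList, Option.map_some]
      refine Eq.trans (b := some ⟨none, none, mk (eb (f x)) [] [] []⟩) rfl ?_
      congr 2
      funext k
      cases k
      · exact (List.map_id _).symm
      all_goals rfl
  · simpa using hn x

end Prog
/-! ### Binary trees on the main stack -/

/-- Binary trees, the data on which programs operate. -/
inductive BTree
  | leaf
  | node (l r : BTree)

/-- The prefix code of a tree. -/
def BTree.code : BTree → List Γ'
  | leaf => [Γ'.bit false]
  | node l r => Γ'.bit true :: (l.code ++ r.code)

def BTree.size (t : BTree) : ℕ := t.code.length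

theorem BTree.size_node (l r : BTree) : (node l r).size = l.size + r.size + 1 := by
  simp [size, code]

theorem BTree.size_pos (t : BTree) : 1 ≤ t.size := by
  cases t <;> simp [size, code]

theorem BTree.blank_notMem_code (t : BTree) : Γ'.blank ∉ t.code := by
  induction t with
  | leaf => simp [code]
  | node l r hl hr => simp [code, hl, hr]

namespace Prog

open Function (update)

@[simp] theorem update_mk_main (m a b c x : List Γ') :
    update (mk m a b c) .main x = mk x a b c := by
  funext k; cases k <;> rfl
@[simp] theorem update_mk_left (m a b c x : List Γ') :
    update (mk m a b c) .left x = mk m x b c := by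
  funext k; cases k <;> rfl
@[simp] theorem update_mk_right (m a b c x : List Γ') :
    update (mk m a b c) .right x = mk m a x c := by
  funext k; cases k <;> rfl
@[simp] theorem update_mk_count (m a b c x : List Γ') :
    update (mk m a b c) .count x = mk m a b x := by
  funext k; cases k <;> rfl
@[simp] theorem mk_main (m a b c : List Γ') : mk m a b c .main = m := rfl
@[simp] theorem mk_left (m a b c : List Γ') : mk m a b c .left = a := rfl
@[simp] theorem mk_right (m a b c : List Γ') : mk m a b c .right = b := rfl
@[simp] theorem mk_count (m a b c : List Γ') : mk m a b c .count = c := rfl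

theorem run_push {k : Stk} {a : Γ'} {s s' : Store} (h : update s k (a :: s k) = s') :
    Run (push k a) s s' 1 := h ▸ .push k a s

theorem run_pop {k : Stk} {s s' : Store} (h : update s k (s k).tail = s') :
    Run (pop k) s s' 1 := h ▸ .pop k s

theorem run_move {k l : Stk} {s s' : Store} (a : Γ') (h : (s k).head? = some a)
    (h' : update (update s k (s k).tail) l (a :: update s k (s k).tail l) = s') :
    Run (move k l) s s' 1 := h' ▸ .move k l s a h

theorem run_fork {k l₁ l₂ : Stk} {s s' : Store} (a : Γ') (h : (s k).head? = some a) (s₁ : Store)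
    (h₁ : s₁ = update (update s k (s k).tail) l₁ (a :: update s k (s k).tail l₁))
    (h₂ : s' = update s₁ l₂ (a :: s₁ l₂)) :
    Run (fork k l₁ l₂) s s' 1 := .fork k l₁ l₂ s a h s₁ s' h₁ h₂

theorem Run.cast {P : Prog} {s s₁ s' s₁' : Store} {n n' : ℕ} (h : Run P s s' n) (h₁ : s = s₁)
    (h₂ : s' = s₁') (h₃ : n = n') : Run P s₁ s₁' n' := by
  subst h₁ h₂ h₃; exact h

/-- One of the two auxiliary stacks. -/
def side : Bool → Stk
  | false => .left
  | true => .right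

/-- The store in which the auxiliary stack `side i` holds `a` and the other one `b`. -/
def mkSide (i : Bool) (m a b c : List Γ') : Store :=
  match i with
  | false => mk m a b c
  | true => mk m b a c

/-- Move the top tree of the main stack to an auxiliary stack. The count stack holds a symbol for
each tree that is still to be read. -/
def stash (i : Bool) : Prog :=
  .seq (.push (side i) Γ'.blank) <| .seq (.push .count Γ'.blank) <|
    .whl .count Option.isSome <|
      .ite .main (fun o => o = some (Γ'.bit true))
        (.seq (.move .main (side i)) (.push .count Γ'.blank))
        (.seq (.move .main (side i)) (.pop .count))

/-- In a prefix code a node symbol turns one pending tree into two, and a leaf completes one, so the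
count stack is back at `c` exactly when `t` has been read. Stating the lemma with a continuation `h`
lets the node case chain its two subtrees. Each symbol costs a loop test, a branch test and two
operations. -/
theorem run_stash_loop (i : Bool) (t : BTree) (r a b c : List Γ') (s' : Store) (n : ℕ)
    (h : Run (.whl .count Option.isSome <|
      .ite .main (fun o => o = some (Γ'.bit true))
        (.seq (.move .main (side i)) (.push .count Γ'.blank))
        (.seq (.move .main (side i)) (.pop .count)))
      (mkSide i r (t.code.reverse ++ a) b c) s' n) :
    Run (.whl .count Option.isSome <|
      .ite .main (fun o => o = some (Γ'.bit true))
        (.seq (.move .main (side i)) (.push .count Γ'.blank))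
        (.seq (.move .main (side i)) (.pop .count)))
      (mkSide i (t.code ++ r) a b (Γ'.blank :: c)) s' (4 * t.size + n) := by
  induction t generalizing r a c n with
  | leaf =>
    refine Run.cast (.whl_true (s₂ := mkSide i r (Γ'.bit false :: a) b c) (m := 3) ?_ ?_ h)
      rfl rfl (by simp [BTree.size, BTree.code]; omega)
    · cases i <;> rfl
    · refine .ite_false (by cases i <;> simp [mkSide, BTree.code])
        (.seq (m := 1) (s₂ := mkSide i r (Γ'.bit false :: a) b (Γ'.blank :: c))
          (run_move (Γ'.bit false) ?_ ?_) (run_pop ?_)) <;>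
      cases i <;> simp [mkSide, BTree.code, side]
  | node u v hu hv =>
    have h₁ := hu (v.code ++ r) (Γ'.bit true :: a) (Γ'.blank :: c) _
      (hv r (u.code.reverse ++ Γ'.bit true :: a) c n (h.cast (by simp [BTree.code]) rfl rfl))
    refine Run.cast (.whl_true (s₂ := mkSide i (u.code ++ (v.code ++ r)) (Γ'.bit true :: a) b
      (Γ'.blank :: Γ'.blank :: c)) (m := 3) ?_ ?_ h₁) rfl rfl (by rw [BTree.size_node]; omega)
    · cases i <;> rfl
    · refine .ite_true (by cases i <;> simp [mkSide, BTree.code])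
        (.seq (m := 1) (s₂ := mkSide i (u.code ++ (v.code ++ r)) (Γ'.bit true :: a) b
            (Γ'.blank :: c))
          (run_move (Γ'.bit true) ?_ ?_) (run_push ?_)) <;>
      cases i <;> simp [mkSide, BTree.code, side]

theorem run_stash (i : Bool) (t : BTree) (r a b : List Γ') :
    Run (stash i) (mkSide i (t.code ++ r) a b [])
      (mkSide i r (t.code.reverse ++ Γ'.blank :: a) b []) (4 * t.size + 3) := by
  refine Run.cast (.seq (s₂ := mkSide i (t.code ++ r) (Γ'.blank :: a) b []) (run_push ?_)
    (.seq (s₂ := mkSide i (t.code ++ r) (Γ'.blank :: a) b [Γ'.blank]) (run_push ?_)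
    (run_stash_loop i t r _ b [] _ 1 (.whl_false ?_)))) rfl rfl (by omega) <;>
  cases i <;> simp [mkSide, side]

/-- Empty an auxiliary stack down to the first blank with the program `P`, and remove the blank. -/
def toBlank (i : Bool) (P : Prog) : Prog :=
  .seq (.whl (side i) (fun o => o ≠ some Γ'.blank) P) (.pop (side i))

/-- The blank below `w` serves as an end marker since it does not occur in `w`. The second reversal
restores the order of the symbols. -/
theorem run_unstash (i : Bool) (w : List Γ') (hw : Γ'.blank ∉ w) (r a b : List Γ') :
    Run (toBlank i (.move (side i) .main)) (mkSide i r (w.reverse ++ Γ'.blank :: a) b [])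
      (mkSide i (w ++ r) a b []) (2 * w.length + 2) := by
  refine Run.cast (.seq (m := 2 * w.length + 1) (s₂ := mkSide i (w ++ r) (Γ'.blank :: a) b [])
    ?_ (run_pop (by cases i <;> simp [mkSide, side]))) rfl rfl (by omega)
  induction w using List.reverseRecOn generalizing r with
  | nil => exact .whl_false (by cases i <;> simp [mkSide, side])
  | append_singleton w x ih =>
    simp only [List.mem_append, List.mem_singleton, not_or] at hw
    refine Run.cast (.whl_true (m := 1) (s₂ := mkSide i (x :: r) (w.reverse ++ Γ'.blank :: a) b [])
      ?_ (run_move x ?_ ?_) (ih hw.1 (x :: r))) rfl (by simp) (by simp; omega)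
    · cases i <;> simpa [mkSide, side] using Ne.symm hw.2
    all_goals cases i <;> simp [mkSide, side]

theorem run_discard (i : Bool) (w : List Γ') (hw : Γ'.blank ∉ w) (r a b : List Γ') :
    Run (toBlank i (.pop (side i))) (mkSide i r (w ++ Γ'.blank :: a) b [])
      (mkSide i r a b []) (2 * w.length + 2) := by
  refine Run.cast (.seq (m := 2 * w.length + 1) (s₂ := mkSide i r (Γ'.blank :: a) b [])
    ?_ (run_pop (by cases i <;> simp [mkSide, side]))) rfl rfl (by omega)
  induction w with
  | nil => exact .whl_false (by cases i <;> simp [mkSide, side])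
  | cons x w ih =>
    simp only [List.mem_cons, not_or] at hw
    refine Run.cast (.whl_true (m := 1) (s₂ := mkSide i r (w ++ Γ'.blank :: a) b [])
      ?_ (run_pop ?_) (ih hw.2)) rfl rfl (by simp; omega)
    · cases i <;> simpa [mkSide, side] using Ne.symm hw.1
    all_goals cases i <;> simp [mkSide, side]

theorem run_copy (w : List Γ') (hw : Γ'.blank ∉ w) (r a b : List Γ') :
    Run (toBlank false (.fork .left .main .right)) (mk r (w.reverse ++ Γ'.blank :: a) b [])
      (mk (w ++ r) a (w ++ b) []) (2 * w.length + 2) := by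
  refine Run.cast (.seq (m := 2 * w.length + 1) (s₂ := mk (w ++ r) (Γ'.blank :: a) (w ++ b) [])
    ?_ (run_pop (by simp [side]))) rfl rfl (by omega)
  induction w using List.reverseRecOn generalizing r b with
  | nil => exact .whl_false (by simp [side])
  | append_singleton w x ih =>
    simp only [List.mem_append, List.mem_singleton, not_or] at hw
    refine Run.cast (.whl_true (m := 1)
      (s₂ := mk (x :: r) (w.reverse ++ Γ'.blank :: a) (x :: b) [])
      ?_ (run_fork x ?_ _ rfl ?_) (ih hw.1 (x :: r) (x :: b))) rfl (by simp) (by simp; omega)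
    · simpa [side] using Ne.symm hw.2
    all_goals simp

theorem run_flip (w : List Γ') (hw : Γ'.blank ∉ w) (r a b : List Γ') :
    Run (toBlank true (.move .right .left)) (mk r a (w ++ Γ'.blank :: b) [])
      (mk r (w.reverse ++ a) b []) (2 * w.length + 2) := by
  refine Run.cast (.seq (m := 2 * w.length + 1) (s₂ := mk r (w.reverse ++ a) (Γ'.blank :: b) [])
    ?_ (run_pop (by simp [side]))) rfl rfl (by omega)
  induction w generalizing a with
  | nil => exact .whl_false (by simp [side])
  | cons x w ih =>
    simp only [List.mem_cons, not_or] at hw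
    refine Run.cast (.whl_true (m := 1) (s₂ := mk r (x :: a) (w ++ Γ'.blank :: b) [])
      ?_ (run_move x ?_ ?_) (ih hw.2 _)) rfl (by simp) (by simp; omega)
    · simpa [side] using Ne.symm hw.1
    all_goals simp

/-- `P` replaces `x` by `y` on top of the main stack in at most `n` steps, whatever is below and on
the auxiliary stacks. -/
def Does (P : Prog) (x y : List Γ') (n : ℕ) : Prop :=
  ∀ r a b, ∃ k ≤ n, Run P (mk (x ++ r) a b []) (mk (y ++ r) a b []) k

theorem Does.seq {P Q : Prog} {x y z : List Γ'} {m n : ℕ} (h₁ : Does P x y m)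
    (h₂ : Does Q y z n) : Does (.seq P Q) x z (m + n) := by
  intro r a b
  obtain ⟨k₁, hk₁, h₁⟩ := h₁ r a b
  obtain ⟨k₂, hk₂, h₂⟩ := h₂ r a b
  exact ⟨_, add_le_add hk₁ hk₂, .seq h₁ h₂⟩

theorem Does.mono {P : Prog} {x y : List Γ'} {m n : ℕ} (h : Does P x y m) (hmn : m ≤ n) :
    Does P x y n := by
  intro r a b
  obtain ⟨k, hk, h⟩ := h r a b
  exact ⟨k, hk.trans hmn, h⟩

theorem Does.frame {P : Prog} {x y : List Γ'} {n : ℕ} (h : Does P x y n) (w : List Γ') :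
    Does P (x ++ w) (y ++ w) n := by
  intro r a b
  simpa using h (w ++ r) a b

theorem Does.ite_true {t : Option Γ' → Bool} {P Q : Prog} {c : Γ'} {x y : List Γ'} {n : ℕ}
    (h : t (some c) = true) (h₁ : Does P (c :: x) y n) :
    Does (.ite .main t P Q) (c :: x) y (n + 1) := by
  intro r a b
  obtain ⟨k, hk, h₁⟩ := h₁ r a b
  exact ⟨k + 1, by omega, .ite_true (by simpa using h) h₁⟩

theorem Does.ite_false {t : Option Γ' → Bool} {P Q : Prog} {c : Γ'} {x y : List Γ'} {n : ℕ}
    (h : t (some c) = false) (h₁ : Does Q (c :: x) y n) :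
    Does (.ite .main t P Q) (c :: x) y (n + 1) := by
  intro r a b
  obtain ⟨k, hk, h₁⟩ := h₁ r a b
  exact ⟨k + 1, by omega, .ite_false (by simpa using h) h₁⟩

theorem Does.whl_true {t : Option Γ' → Bool} {P : Prog} {c : Γ'} {x y z : List Γ'} {m n : ℕ}
    (h : t (some c) = true) (h₁ : Does P (c :: x) y m) (h₂ : Does (.whl .main t P) y z n) :
    Does (.whl .main t P) (c :: x) z (m + n + 1) := by
  intro r a b
  obtain ⟨k₁, hk₁, h₁⟩ := h₁ r a b
  obtain ⟨k₂, hk₂, h₂⟩ := h₂ r a b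
  exact ⟨k₁ + k₂ + 1, by omega, .whl_true (by simpa using h) h₁ h₂⟩

theorem Does.whl_false {t : Option Γ' → Bool} {P : Prog} {c : Γ'} {x : List Γ'}
    (h : t (some c) = false) : Does (.whl .main t P) (c :: x) (c :: x) 1 := by
  intro r a b
  exact ⟨1, le_rfl, .whl_false (by simpa using h)⟩

theorem does_push (c : Γ') (x : List Γ') : Does (.push .main c) x (c :: x) 1 :=
  fun r a b => ⟨1, le_rfl, run_push (by simp)⟩

theorem does_pop (c : Γ') (x : List Γ') : Does (.pop .main) (c :: x) x 1 :=
  fun r a b => ⟨1, le_rfl, run_pop (by simp)⟩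

def drop : Prog := .seq (stash false) (toBlank false (.pop .left))

theorem does_drop (t : BTree) : Does drop t.code [] (6 * t.size + 5) := by
  intro r a b
  refine ⟨_, le_rfl, Run.cast (.seq (run_stash false t r a b) (run_discard false t.code.reverse
    (by simpa using t.blank_notMem_code) r a b)) rfl rfl ?_⟩
  simp [BTree.size]; omega

/-- Run `P` below the top tree. -/
def dip (P : Prog) : Prog := .seq (stash false) (.seq P (toBlank false (.move .left .main)))

theorem Does.dip {P : Prog} {x y : List Γ'} {n : ℕ} (h : Does P x y n) (t : BTree) :
    Does (dip P) (t.code ++ x) (t.code ++ y) (6 * t.size + n + 5) := by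
  intro r a b
  obtain ⟨k, hk, h⟩ := h r (t.code.reverse ++ Γ'.blank :: a) b
  refine ⟨6 * t.size + k + 5, by omega, Run.cast (.seq (run_stash false t (x ++ r) a b)
    (.seq h (run_unstash false t.code t.blank_notMem_code (y ++ r) a b))) ?_ ?_ ?_⟩
  · simp [mkSide]
  · simp [mkSide]
  · simp [BTree.size]; omega

/-- Exchange the two top trees. -/
def swap : Prog :=
  .seq (stash false) (.seq (stash true) (.seq (toBlank false (.move .left .main))
    (toBlank true (.move .right .main))))

theorem does_swap (t u : BTree) :
    Does swap (t.code ++ u.code) (u.code ++ t.code) (6 * t.size + 6 * u.size + 10) := by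
  intro r a b
  refine ⟨_, le_rfl, Run.cast (.seq (run_stash false t (u.code ++ r) a b)
    (.seq (run_stash true u r b (t.code.reverse ++ Γ'.blank :: a))
    (.seq (run_unstash false t.code t.blank_notMem_code r a (u.code.reverse ++ Γ'.blank :: b))
      (run_unstash true u.code u.blank_notMem_code (t.code ++ r) b a)))) ?_ ?_ ?_⟩
  · simp [mkSide]
  · simp [mkSide]
  · simp [BTree.size]; omega

/-- Duplicate the top tree. -/
def dup : Prog :=
  .seq (stash false) (.seq (.push .right Γ'.blank)
    (.seq (toBlank false (.fork .left .main .right))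
    (.seq (.push .left Γ'.blank) (.seq (toBlank true (.move .right .left))
      (toBlank false (.move .left .main))))))

/-- The fork leaves an unreversed copy on the right stack. It passes through the left stack so that
moving it to the main stack yields it in the right order. -/
theorem does_dup (t : BTree) : Does dup t.code (t.code ++ t.code) (10 * t.size + 11) := by
  intro r a b
  refine ⟨_, le_rfl, Run.cast (.seq (run_stash false t r a b)
    (.seq (s₂ := mk r (t.code.reverse ++ Γ'.blank :: a) (Γ'.blank :: b) []) (run_push ?_)
    (.seq (run_copy t.code t.blank_notMem_code r a (Γ'.blank :: b))
    (.seq (run_push (by simp)) (.seq (run_flip t.code t.blank_notMem_code _ _ b)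
      (run_unstash false t.code t.blank_notMem_code (t.code ++ r) a b)))))) ?_ ?_ ?_⟩
  · simp [mkSide]
  · simp [mkSide]
  · simp [mkSide]
  · simp [BTree.size]; omega

end Prog
/-! ### Polynomial-time functions on types that are represented by trees -/

/-- A representation of the elements of a type by trees. -/
class Enc (α : Type) where
  tree : α → BTree

open Enc (tree)

/-- The size of the representation of an object. -/
def sz {α : Type} [Enc α] (x : α) : ℕ := (tree x).size

instance : Enc Unit := ⟨fun _ => .leaf⟩
instance : Enc Bool := ⟨fun b => bif b then .node .leaf .leaf else .leaf⟩
instance {α β : Type} [Enc α] [Enc β] : Enc (α × β) := ⟨fun x => .node (tree x.1) (tree x.2)⟩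

def listTree {α : Type} [Enc α] : List α → BTree
  | [] => .leaf
  | x :: l => .node (tree x) (listTree l)

instance {α : Type} [Enc α] : Enc (List α) := ⟨listTree⟩

/-- Natural numbers are represented in unary. -/
def natTree : ℕ → BTree
  | 0 => .leaf
  | n + 1 => .node .leaf (natTree n)

instance : Enc ℕ := ⟨natTree⟩

section
variable {α β γ : Type} [Enc α] [Enc β] [Enc γ]

@[simp] theorem tree_nil : tree ([] : List α) = .leaf := rfl
@[simp] theorem tree_zero : tree 0 = .leaf := rfl
@[simp] theorem tree_succ (n : ℕ) : tree (n + 1) = .node .leaf (tree n) := rfl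
@[simp] theorem tree_unit (x : Unit) : tree x = .leaf := rfl
@[simp] theorem sz_nil : sz ([] : List α) = 1 := rfl
@[simp] theorem tree_cons (x : α) (l : List α) : tree (x :: l) = .node (tree x) (tree l) := rfl
@[simp] theorem tree_pair (x : α) (y : β) : tree (x, y) = .node (tree x) (tree y) := rfl

theorem sz_pos (x : α) : 1 ≤ sz x := BTree.size_pos _
@[simp] theorem sz_pair (x : α) (y : β) : sz (x, y) = sz x + sz y + 1 := BTree.size_node _ _
@[simp] theorem sz_cons (x : α) (l : List α) : sz (x :: l) = sz x + sz l + 1 :=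
  BTree.size_node _ _
@[simp] theorem sz_nat (n : ℕ) : sz n = 2 * n + 1 := by
  induction n with
  | zero => rfl
  | succ n ih =>
    have : sz (n + 1) = 1 + sz n + 1 := BTree.size_node _ _
    omega
theorem sz_bool_le (b : Bool) : sz b ≤ 3 := by cases b <;> decide

theorem length_le_sz (l : List α) : l.length ≤ sz l := by
  induction l with
  | nil => simp
  | cons x l ih => simp; omega

theorem sz_append (l₁ l₂ : List α) : sz (l₁ ++ l₂) + 1 = sz l₁ + sz l₂ := by
  induction l₁ with
  | nil => simp; omega
  | cons x l ih => simp; omega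

theorem sz_reverse (l : List α) : sz l.reverse = sz l := by
  induction l with
  | nil => rfl
  | cons x l ih =>
    have := sz_append l.reverse [x]
    simp at this ⊢; omega

theorem sz_le_of_mem {x : α} {l : List α} (h : x ∈ l) : sz x ≤ sz l := by
  induction l with
  | nil => simp at h
  | cons y l ih =>
    rcases List.mem_cons.1 h with rfl | h
    · simp; omega
    · have := ih h
      simp; omega

theorem sz_le_of_forall {l : List α} {n : ℕ} (h : ∀ x ∈ l, sz x ≤ n) :
    sz l ≤ l.length * (n + 1) + 1 := by
  induction l with
  | nil => simp
  | cons y l ih =>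
    have h₁ := ih fun x hx => h x (by simp [hx])
    have h₂ := h y (by simp)
    simp only [sz_cons, List.length_cons, add_mul]
    omega

end

theorem eval_le_eval (p : Polynomial ℕ) {m n : ℕ} (h : m ≤ n) : p.eval m ≤ p.eval n := by
  simp only [Polynomial.eval_eq_sum_range]
  gcongr

open Prog

/-- The function `f` is computed, on representations by trees, in polynomial time. -/
@[fun_prop]
def PolyTime {α β : Type} [Enc α] [Enc β] (f : α → β) : Prop :=
  ∃ (P : Prog) (p : Polynomial ℕ), ∀ x,
    Does P (tree x).code (tree (f x)).code (p.eval (sz x)) ∧ sz (f x) ≤ p.eval (sz x)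

namespace PolyTime

variable {α β γ δ : Type} [Enc α] [Enc β] [Enc γ] [Enc δ]

/-- Changes of type that keep the tree are free: a nonempty list is represented like the pair of its
head and tail, and a successor like a pair with `()`. -/
theorem of_tree_eq {f : α → β} (h : ∀ x, tree (f x) = tree x) : PolyTime f := by
  -- There is no empty program; a push followed by a pop takes its place.
  refine ⟨.seq (.push .main Γ'.blank) (.pop .main), Polynomial.X + 2, fun x => ⟨?_, ?_⟩⟩
  · rw [h]
    exact ((does_push _ _).seq (does_pop _ _)).mono (by simp)
  · simp [sz, h]

theorem congr {f g : α → β} (hf : PolyTime f) (h : ∀ x, f x = g x) : PolyTime g :=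
  funext h ▸ hf

@[fun_prop]
protected theorem id : PolyTime (fun x : α => x) := of_tree_eq fun _ => rfl

-- The size bound in `PolyTime` is what allows the time bound of the second program to be evaluated
-- at a polynomial in the size of `x`.
@[fun_prop]
theorem comp {g : β → γ} {f : α → β} (hg : PolyTime g) (hf : PolyTime f) :
    PolyTime (fun x => g (f x)) := by
  obtain ⟨P, p, hP⟩ := hf
  obtain ⟨Q, q, hQ⟩ := hg
  refine ⟨.seq P Q, p + q.comp p, fun x => ?_⟩
  obtain ⟨h₁, h₂⟩ := hP x
  obtain ⟨h₃, h₄⟩ := hQ (f x)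
  have := eval_le_eval q h₂
  refine ⟨(h₁.seq h₃).mono ?_, ?_⟩ <;>
  · simp only [Polynomial.eval_add, Polynomial.eval_comp]; omega

def pushAll : List Γ' → Prog
  | [] => .seq (.push .main Γ'.blank) (.pop .main)
  | c :: w => .seq (pushAll w) (.push .main c)

theorem does_pushAll (w x : List Γ') : Does (pushAll w) x (w ++ x) (w.length + 2) := by
  induction w with
  | nil => exact ((does_push _ _).seq (does_pop _ _)).mono (by simp)
  | cons c w ih => exact (ih.seq (does_push _ _)).mono (by simp)

@[fun_prop]
theorem const (c : β) : PolyTime (fun _ : α => c) := by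
  refine ⟨.seq drop (pushAll (tree c).code), 6 * Polynomial.X + 7 + (sz c : Polynomial ℕ),
    fun x => ⟨?_, ?_⟩⟩
  · have := ((does_drop (tree x)).seq (does_pushAll (tree c).code []))
    rw [List.append_nil] at this
    exact this.mono (by simp [sz, BTree.size]; omega)
  · simp

-- The trees on the stack, from the top, are `x, x`, then `f x, x`, then `x, f x`, then `g x, f x`,
-- then `f x, g x`; a node symbol in front makes them a pair.
@[fun_prop]
theorem pair {f : α → β} {g : α → γ} (hf : PolyTime f) (hg : PolyTime g) :
    PolyTime (fun x => (f x, g x)) := by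
  obtain ⟨P, p, hP⟩ := hf
  obtain ⟨Q, q, hQ⟩ := hg
  refine ⟨.seq dup (.seq P (.seq swap (.seq Q (.seq swap (.push .main (Γ'.bit true)))))),
    16 * Polynomial.X + 32 + 13 * p + 7 * q, fun x => ?_⟩
  obtain ⟨h₁, h₂⟩ := hP x
  obtain ⟨h₃, h₄⟩ := hQ x
  refine ⟨((does_dup (tree x)).seq ((h₁.frame _).seq ((does_swap _ _).seq ((h₃.frame _).seq
    ((does_swap _ _).seq (does_push _ _)))))).mono ?_, ?_⟩
  · simp only [sz] at *
    simp; omega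
  · simp; omega

@[fun_prop]
theorem fst {f : α → β × γ} (hf : PolyTime f) : PolyTime (fun x => (f x).1) := by
  refine comp (g := Prod.fst) ⟨.seq (.pop .main) (dip drop), 12 * Polynomial.X + 11,
    fun x => ⟨?_, ?_⟩⟩ hf
  · have := (does_pop (Γ'.bit true) _).seq ((does_drop (tree x.2)).dip (tree x.1))
    rw [List.append_nil] at this
    refine this.mono ?_
    have : sz x = sz x.1 + sz x.2 + 1 := sz_pair x.1 x.2
    simp [this]
    simp [sz]; omega
  · have : sz x = sz x.1 + sz x.2 + 1 := sz_pair x.1 x.2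
    simp; omega

@[fun_prop]
theorem snd {f : α → β × γ} (hf : PolyTime f) : PolyTime (fun x => (f x).2) := by
  refine comp (g := Prod.snd) ⟨.seq (.pop .main) drop, 6 * Polynomial.X + 6,
    fun x => ⟨?_, ?_⟩⟩ hf
  · refine ((does_pop (Γ'.bit true) _).seq ((does_drop (tree x.1)).frame (tree x.2).code)).mono ?_
    have : sz x = sz x.1 + sz x.2 + 1 := sz_pair x.1 x.2
    simp [this]
    simp [sz]; omega
  · have : sz x = sz x.1 + sz x.2 + 1 := sz_pair x.1 x.2
    simp; omega

/-- Case distinction on whether a tree is a leaf. -/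
theorem cases {t : α → δ} {f g : α → β} {h : α × γ → β} (ht : PolyTime t) (hg : PolyTime g)
    (hh : PolyTime h)
    (H : ∀ x, (tree (t x) = .leaf ∧ f x = g x) ∨
      ∃ (y : γ) (u v : BTree), tree (t x) = .node u v ∧ tree y = .node u v ∧ f x = h (x, y)) :
    PolyTime f := by
  obtain ⟨P, p, hP⟩ := ht
  obtain ⟨Q, q, hQ⟩ := hg
  obtain ⟨R, r, hR⟩ := hh
  refine ⟨.seq dup (.seq P (.ite .main (fun o => o = some (Γ'.bit true))
    (.seq swap (.seq (.push .main (Γ'.bit true)) R)) (.seq drop Q))),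
    16 * Polynomial.X + 40 + 7 * p + q + r.comp (Polynomial.X + p + 1), fun x => ?_⟩
  obtain ⟨h₁, h₂⟩ := hP x
  obtain ⟨h₃, h₄⟩ := hQ x
  rcases H x with ⟨hl, hf⟩ | ⟨y, u, v, hn, hy, hf⟩
  · rw [hf]
    have key := Does.ite_false (t := fun o => o = some (Γ'.bit true))
      (P := .seq swap (.seq (.push .main (Γ'.bit true)) R)) (c := Γ'.bit false) (by simp)
      (((does_drop .leaf).frame (tree x).code).seq h₃)
    change Does _ (BTree.leaf.code ++ (tree x).code) _ _ at key
    rw [← hl] at key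
    refine ⟨((does_dup (tree x)).seq ((h₁.frame _).seq key)).mono ?_, ?_⟩
    · simp only [sz] at *
      simp; omega
    · simp; omega
  · rw [hf]
    obtain ⟨h₅, h₆⟩ := hR (x, y)
    have hs : sz (x, y) ≤ sz x + p.eval (sz x) + 1 := by
      rw [hn, ← hy] at h₁
      have : sz (t x) = sz y := by simp [sz, hn, hy]
      rw [sz_pair]
      omega
    have hr := eval_le_eval r hs
    -- After the exchange and a node symbol, the stack holds the code of `(x, y)`, because `y` has
    -- the same tree as `t x`; so the program for `h` can run.
    have key := Does.ite_true (t := fun o => o = some (Γ'.bit true)) (Q := .seq drop Q)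
      (c := Γ'.bit true) (x := (u.code ++ v.code) ++ (tree x).code) (by simp)
      ((does_swap (.node u v) (tree x)).seq ((does_push (Γ'.bit true) _).seq
        (by rw [tree_pair, hy] at h₅; exact h₅)))
    change Does _ ((BTree.node u v).code ++ (tree x).code) _ _ at key
    rw [← hn] at key
    refine ⟨((does_dup (tree x)).seq ((h₁.frame _).seq key)).mono ?_, ?_⟩
    · simp only [sz] at *
      simp [Polynomial.eval_comp, -tree_pair]; omega
    · simp [Polynomial.eval_comp]; omega

theorem cond {c : α → Bool} {f g : α → β} (hc : PolyTime c) (hf : PolyTime f) (hg : PolyTime g) :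
    PolyTime (fun x => bif c x then f x else g x) := by
  refine cases (γ := Bool) (h := fun z => f z.1) hc hg (hf.comp (fst .id)) fun x => ?_
  cases c x
  · exact .inl ⟨rfl, rfl⟩
  · exact .inr ⟨true, .leaf, .leaf, rfl, rfl, rfl⟩

@[fun_prop]
theorem ite {c : α → Prop} [DecidablePred c] {f g : α → β} (hc : PolyTime (fun x => decide (c x)))
    (hf : PolyTime f) (hg : PolyTime g) : PolyTime (fun x => if c x then f x else g x) := by
  simpa only [Bool.cond_decide] using cond hc hf hg

@[fun_prop]
theorem cons {f : α → β} {l : α → List β} (hf : PolyTime f) (hl : PolyTime l) :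
    PolyTime (fun x => f x :: l x) :=
  (of_tree_eq (f := fun z : β × List β => z.1 :: z.2) fun _ => rfl).comp (pair hf hl)

theorem list_casesOn {l : α → List γ} {g : α → β} {h : α × γ × List γ → β} (hl : PolyTime l)
    (hg : PolyTime g) (hh : PolyTime h) :
    PolyTime (fun x => match l x with
      | [] => g x
      | c :: t => h (x, c, t)) := by
  refine cases hl hg hh fun x => ?_
  cases l x with
  | nil => exact .inl ⟨rfl, rfl⟩
  | cons c t => exact .inr ⟨(c, t), tree c, tree t, rfl, rfl, rfl⟩

@[fun_prop]
theorem succ {f : α → ℕ} (hf : PolyTime f) : PolyTime (fun x => f x + 1) :=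
  (of_tree_eq (f := fun z : Unit × ℕ => z.2 + 1) fun _ => rfl).comp (pair (const ()) hf)

@[fun_prop]
theorem pred {f : α → ℕ} (hf : PolyTime f) : PolyTime (fun x => f x - 1) := by
  refine cases (g := fun _ => 0) (h := fun z : α × Unit × ℕ => z.2.2) hf (const 0)
    (by fun_prop) fun x => ?_
  cases f x with
  | zero => exact .inl ⟨rfl, rfl⟩
  | succ n => exact .inr ⟨((), n), .leaf, tree n, rfl, rfl, rfl⟩

theorem replicate_unit {f : α → ℕ} (hf : PolyTime f) :
    PolyTime (fun x => List.replicate (f x) ()) := by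
  refine (of_tree_eq (f := fun n : ℕ => List.replicate n ()) fun n => ?_).comp hf
  induction n with
  | zero => rfl
  | succ n ih => simp [List.replicate_succ, ih]

/-- The loop that folds a list. -/
def foldProg (P : Prog) : Prog :=
  .seq (.pop .main) (.seq swap (.seq
    (.whl .main (fun o => o = some (Γ'.bit true))
      (.seq (.pop .main) (.seq swap (dip (.seq (.push .main (Γ'.bit true)) P)))))
    (.pop .main)))

/-- One round removes the node symbol of the list, moves the remaining list above its head, and
below it joins the head and the accumulator to a pair on which `P` runs. `B` bounds all intermediate
accumulators, which makes the cost of a round uniform. -/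
theorem does_fold_loop {step : β → γ → β} {P : Prog} {p : Polynomial ℕ}
    (hP : ∀ b c, Does P (tree (c, b)).code (tree (step b c)).code (p.eval (sz (c, b)))) (B S : ℕ)
    (l : List γ) (hl : sz l ≤ S) (b : β)
    (hB : ∀ l₁ l₂, l = l₁ ++ l₂ → sz (l₁.foldl step b) ≤ B) :
    Does (.whl .main (fun o => o = some (Γ'.bit true))
        (.seq (.pop .main) (.seq swap (dip (.seq (.push .main (Γ'.bit true)) P)))))
      ((tree l).code ++ (tree b).code) (Γ'.bit false :: (tree (l.foldl step b)).code)
      (l.length * (12 * S + 22 + p.eval (S + B + 1)) + 1) := by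
  induction l generalizing b with
  | nil => exact (Does.whl_false (by simp)).mono (by simp)
  | cons c l ih =>
    simp only [sz_cons] at hl
    have h₁ := ih (by omega) (step b c) fun l₁ l₂ h => hB (c :: l₁) l₂ (by simp [h])
    have hb : sz b ≤ B := hB [] _ rfl
    have h₂ := (does_push (Γ'.bit true) ((tree c).code ++ (tree b).code)).seq (hP b c)
    have h₃ := eval_le_eval p (show sz (c, b) ≤ S + B + 1 by simp; omega)
    have h₄ := Does.whl_true (t := fun o => o = some (Γ'.bit true)) (by simp)
      ((does_pop (Γ'.bit true) _).seq (((does_swap (tree c) (tree l)).frame (tree b).code).seq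
      (by rw [List.append_assoc]; exact h₂.dip (tree l)))) h₁
    rw [tree_cons]
    simp only [BTree.code, List.cons_append]
    refine h₄.mono ?_
    simp only [sz, List.length_cons, add_mul] at *
    omega

/-- Folding a list, where the intermediate results have polynomial size. -/
theorem foldl_of_bound {init : α → β} {l : α → List γ} {step : β → γ → β} (hi : PolyTime init)
    (hl : PolyTime l) (hs : PolyTime (fun z : γ × β => step z.2 z.1)) (q : Polynomial ℕ)
    (hq : ∀ x l₁ l₂, l x = l₁ ++ l₂ → sz (l₁.foldl step (init x)) ≤ q.eval (sz x)) :
    PolyTime (fun x => (l x).foldl step (init x)) := by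
  obtain ⟨Q, r, hQ⟩ := pair hi hl
  obtain ⟨P, p, hP⟩ := hs
  refine ⟨.seq Q (foldProg P), r + 6 * r + 13 + (r * (12 * r + 22 + p.comp (r + q + 1)) + 1) + q,
    fun x => ?_⟩
  obtain ⟨h₁, h₂⟩ := hQ x
  rw [sz_pair] at h₂
  have h₃ := does_fold_loop (fun b c => (hP (c, b)).1) (q.eval (sz x)) (r.eval (sz x)) (l x)
    (by omega) (init x) (hq x)
  refine ⟨(h₁.seq ((does_pop (Γ'.bit true) _).seq ((does_swap _ _).seq
    (h₃.seq (does_pop _ _))))).mono ?_, ?_⟩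
  · have h₄ : (l x).length ≤ r.eval (sz x) := (length_le_sz _).trans (by omega)
    have h₅ := Nat.mul_le_mul_right (12 * r.eval (sz x) + 22 +
      p.eval (r.eval (sz x) + q.eval (sz x) + 1)) h₄
    simp only [sz] at *
    simp [Polynomial.eval_comp]
    omega
  · have := hq x (l x) [] (by simp)
    simp; omega

/-- Folding with parameters. -/
theorem foldl {init : α → β} {l : α → List γ} {step : α → β → γ → β} (hi : PolyTime init)
    (hl : PolyTime l) (hs : PolyTime (fun z : α × β × γ => step z.1 z.2.1 z.2.2))
    (q : Polynomial ℕ)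
    (hq : ∀ x l₁ l₂, l x = l₁ ++ l₂ → sz (l₁.foldl (step x) (init x)) ≤ q.eval (sz x)) :
    PolyTime (fun x => (l x).foldl (step x) (init x)) := by
  have key : ∀ (x : α) (l : List γ) (b : β),
      l.foldl (fun (s : α × β) c => (s.1, step s.1 s.2 c)) (x, b) = (x, l.foldl (step x) b) := by
    intro x l
    induction l with
    | nil => intro b; rfl
    | cons c l ih => intro b; exact ih _
  -- The loop body sees only the item and the accumulator, so the parameter travels inside the
  -- accumulator.
  have h := foldl_of_bound (init := fun x => (x, init x)) (l := l)
    (step := fun (s : α × β) c => (s.1, step s.1 s.2 c)) (pair .id hi) hl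
    (pair (by fun_prop) (hs.comp (f := fun z : γ × α × β => (z.2.1, z.2.2, z.1)) (by fun_prop)))
    (Polynomial.X + q + 1) (fun x l₁ l₂ h => by
      rw [key, sz_pair]
      have := hq x l₁ l₂ h
      simp; omega)
  simpa only [key] using snd h

/-- Folding with parameters, where each step increases the size by an amount that is independent
of the accumulated value. -/
theorem foldl_of_growth {init : α → β} {l : α → List γ} {step : α → β → γ → β}
    (hi : PolyTime init) (hl : PolyTime l)
    (hs : PolyTime (fun z : α × β × γ => step z.1 z.2.1 z.2.2)) (q : Polynomial ℕ)
    (hq : ∀ x b c, sz (step x b c) ≤ sz b + q.eval (sz x + sz c)) :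
    PolyTime (fun x => (l x).foldl (step x) (init x)) := by
  obtain ⟨_, r₁, h₁⟩ := id hi
  obtain ⟨_, r₂, h₂⟩ := id hl
  refine foldl hi hl hs (r₁ + r₂ * q.comp (Polynomial.X + r₂)) fun x l₁ l₂ h => ?_
  have key : ∀ (l : List γ) (S : ℕ) (b : β), (∀ c ∈ l, sz c ≤ S) →
      sz (l.foldl (step x) b) ≤ sz b + l.length * q.eval (sz x + S) := by
    intro l S
    induction l with
    | nil => simp
    | cons c l ih =>
      intro b hc
      have h₁ := ih (step x b c) fun c h => hc c (by simp [h])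
      have h₂ := hq x b c
      have h₃ := eval_le_eval q (Nat.add_le_add_left (hc c (by simp)) (sz x))
      simp only [List.foldl_cons, List.length_cons, add_mul]
      omega
  have h₃ := key l₁ (r₂.eval (sz x)) (init x) fun c hc =>
    (sz_le_of_mem (l := l x) (by simp [h, hc])).trans (h₂ x).2
  have h₄ : l₁.length ≤ r₂.eval (sz x) := by
    have := length_le_sz (l x)
    have := (h₂ x).2
    have : (l x).length = l₁.length + l₂.length := by simp [h]
    omega
  have h₅ := Nat.mul_le_mul_right (q.eval (sz x + r₂.eval (sz x))) h₄
  have h₆ := (h₁ x).2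
  simp [Polynomial.eval_comp]
  omega

end PolyTime
open Enc (tree)

namespace PolyTime

variable {α β γ δ : Type} [Enc α] [Enc β] [Enc γ] [Enc δ]

attribute [fun_prop] cond

/-! ### Lists -/

@[fun_prop]
theorem headD {l : α → List β} {d : α → β} (hl : PolyTime l) (hd : PolyTime d) :
    PolyTime (fun x => (l x).headD (d x)) := by
  refine (list_casesOn hl hd (h := fun z => z.2.1) (by fun_prop)).congr fun x => ?_
  cases l x <;> rfl

@[fun_prop]
theorem tail {l : α → List β} (hl : PolyTime l) : PolyTime (fun x => (l x).tail) := by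
  refine (list_casesOn hl (const []) (h := fun z => z.2.2) (by fun_prop)).congr fun x => ?_
  cases l x <;> rfl

@[fun_prop]
theorem reverse {l : α → List β} (hl : PolyTime l) : PolyTime (fun x => (l x).reverse) := by
  refine (foldl_of_growth (init := fun _ => []) (step := fun _ b c => c :: b) (by fun_prop) hl
    (by fun_prop) (Polynomial.X + 1) fun x b c => ?_).congr fun x => ?_
  · simp; omega
  · simp

@[fun_prop]
theorem append {l₁ l₂ : α → List β} (h₁ : PolyTime l₁) (h₂ : PolyTime l₂) :
    PolyTime (fun x => l₁ x ++ l₂ x) := by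
  refine (foldl_of_growth (init := l₂) (l := fun x => (l₁ x).reverse)
    (step := fun _ b c => c :: b) (by fun_prop) (by fun_prop)
    (by fun_prop) (Polynomial.X + 1) fun x b c => ?_).congr fun x => ?_
  · simp; omega
  · simp

@[fun_prop]
theorem flatMap {l : α → List β} {f : α → β → List γ} (hl : PolyTime l)
    (hf : PolyTime (fun z : α × β => f z.1 z.2)) :
    PolyTime (fun x => (l x).flatMap (fun y => f x y)) := by
  obtain ⟨_, q, hq⟩ := hf.comp .id
  refine (foldl_of_growth (init := fun _ => []) (l := fun x => (l x).reverse)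
    (step := fun x b c => f x c ++ b) (by fun_prop) (by fun_prop)
    (append (hf.comp (f := fun z : α × List γ × β => (z.1, z.2.2)) (by fun_prop)) (by fun_prop))
    (q.comp (Polynomial.X + 1)) fun x b c => ?_).congr fun x => ?_
  · have h₁ := (hq (x, c)).2
    have h₂ := sz_append (f x c) b
    simp [Polynomial.eval_comp] at h₁ ⊢
    omega
  · rw [List.foldl_reverse]
    induction l x with
    | nil => rfl
    | cons y l ih => simp [ih]

@[fun_prop]
theorem map {l : α → List β} {f : α → β → γ} (hl : PolyTime l)
    (hf : PolyTime (fun z : α × β => f z.1 z.2)) :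
    PolyTime (fun x => (l x).map (fun y => f x y)) := by
  refine (flatMap hl (f := fun x y => [f x y]) (by fun_prop)).congr fun x => ?_
  induction l x with
  | nil => rfl
  | cons y l ih => simp [ih]

@[fun_prop]
theorem length {l : α → List β} (hl : PolyTime l) : PolyTime (fun x => (l x).length) := by
  refine (foldl_of_growth (init := fun _ => 0) (step := fun _ n _ => n + 1) (by fun_prop) hl
    (by fun_prop) 2 fun x b c => ?_).congr fun x => ?_
  · simp; omega
  · simp

/-- Iteration, where each step increases the size by an amount that is independent of the
accumulated value. -/
theorem iterate_of_growth {init : α → β} {n : α → ℕ} {step : α → β → β}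
    (hi : PolyTime init) (hn : PolyTime n)
    (hs : PolyTime (fun z : α × β => step z.1 z.2)) (q : Polynomial ℕ)
    (hq : ∀ x b, sz (step x b) ≤ sz b + q.eval (sz x)) :
    PolyTime (fun x => (step x)^[n x] (init x)) := by
  refine (foldl_of_growth (step := fun x b _ => step x b) hi (replicate_unit hn)
    (hs.comp (f := fun z : α × β × Unit => (z.1, z.2.1)) (by fun_prop)) q
    fun x b c => ?_).congr fun x => ?_
  · exact (hq x b).trans (Nat.add_le_add_left (eval_le_eval q (by omega)) _)
  · generalize init x = b
    induction n x generalizing b with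
    | zero => rfl
    | succ n ih => simp [List.replicate_succ, ih]

@[fun_prop]
theorem add {f g : α → ℕ} (hf : PolyTime f) (hg : PolyTime g) : PolyTime (fun x => f x + g x) := by
  refine (iterate_of_growth (step := fun _ n => n + 1) hf hg (by fun_prop) 2 fun x b => ?_).congr
    fun x => ?_
  · simp; omega
  · simp

@[fun_prop]
theorem sub {f g : α → ℕ} (hf : PolyTime f) (hg : PolyTime g) : PolyTime (fun x => f x - g x) := by
  refine (iterate_of_growth (step := fun _ n => n - 1) hf hg (by fun_prop) 0 fun x b => ?_).congr
    fun x => ?_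
  · simp
  · induction g x with
    | zero => rfl
    | succ n ih => rw [Function.iterate_succ_apply', ih]; omega

@[fun_prop]
theorem drop {n : α → ℕ} {l : α → List β} (hn : PolyTime n) (hl : PolyTime l) :
    PolyTime (fun x => (l x).drop (n x)) := by
  refine (iterate_of_growth (step := fun _ l => l.tail) hl hn (by fun_prop) 0 fun x b => ?_).congr
    fun x => ?_
  · cases b <;> simp; omega
  · induction n x with
    | zero => rfl
    | succ n ih => rw [Function.iterate_succ_apply', ih]; simp

@[fun_prop]
theorem getD {n : α → ℕ} {l : α → List β} {d : α → β} (hl : PolyTime l) (hn : PolyTime n)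
    (hd : PolyTime d) : PolyTime (fun x => (l x).getD (n x) (d x)) := by
  refine (headD (drop hn hl) hd).congr fun x => ?_
  simp [List.headD_eq_head?_getD, List.head?_drop]

@[fun_prop]
theorem replicate {n : α → ℕ} {f : α → β} (hn : PolyTime n) (hf : PolyTime f) :
    PolyTime (fun x => List.replicate (n x) (f x)) := by
  refine (map (replicate_unit hn) (f := fun x _ => f x)
    (hf.comp (f := fun z : α × Unit => z.1) (by fun_prop))).congr fun x => ?_
  simp

-- The list is built by appending its current length. The growth of a step depends on the
-- accumulator, so `foldl_of_growth` does not apply and the size is bounded directly.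
@[fun_prop]
theorem range {n : α → ℕ} (hn : PolyTime n) : PolyTime (fun x => List.range (n x)) := by
  have key : ∀ l : List Unit, l.foldl (fun (r : List ℕ) _ => r ++ [r.length]) [] =
      List.range l.length := by
    intro l
    induction l using List.reverseRecOn with
    | nil => rfl
    | append_singleton l x ih => simp [ih, List.range_succ]
  obtain ⟨_, q, hq⟩ := hn.comp .id
  refine (foldl_of_bound (init := fun _ => []) (step := fun (r : List ℕ) (_ : Unit) =>
    r ++ [r.length]) (const []) (replicate_unit hn) (by fun_prop) (q * (2 * q + 2) + 1)
    fun x l₁ l₂ h => ?_).congr fun x => ?_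
  · rw [key]
    have h₁ : l₁.length ≤ n x := by
      have := congrArg List.length h
      simp at this; omega
    have h₂ := (hq x).2
    refine (sz_le_of_forall (n := 2 * (n x) + 1) fun i hi => ?_).trans ?_
    · simp at hi ⊢; omega
    · simp at h₂ ⊢
      nlinarith
  · rw [key]; simp

/-! ### Decidable relations -/

@[fun_prop]
theorem decide_and {p q : α → Prop} [DecidablePred p] [DecidablePred q]
    (hp : PolyTime (fun x => decide (p x))) (hq : PolyTime (fun x => decide (q x))) :
    PolyTime (fun x => decide (p x ∧ q x)) := by
  refine (cond hp hq (const false)).congr fun x => ?_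
  by_cases h : p x <;> simp [h]

-- The truncated difference is represented by a leaf exactly when the inequality holds.
@[fun_prop]
theorem decide_le {f g : α → ℕ} (hf : PolyTime f) (hg : PolyTime g) :
    PolyTime (fun x => decide (f x ≤ g x)) := by
  refine cases (γ := ℕ) (g := fun _ => true) (h := fun _ => false) (sub hf hg) (const _) (const _)
    fun x => ?_
  rcases h : f x - g x with _ | n
  · exact .inl ⟨rfl, by simp; omega⟩
  · exact .inr ⟨n + 1, .leaf, tree n, rfl, rfl, by simp; omega⟩

@[fun_prop]
theorem decide_eq_nat {f g : α → ℕ} (hf : PolyTime f) (hg : PolyTime g) :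
    PolyTime (fun x => decide (f x = g x)) := by
  refine (decide_and (decide_le hf hg) (decide_le hg hf)).congr fun x => ?_
  simp [le_antisymm_iff]

@[fun_prop]
theorem decide_eq_bool {f g : α → Bool} (hf : PolyTime f) (hg : PolyTime g) :
    PolyTime (fun x => decide (f x = g x)) := by
  refine (cond hf hg (cond hg (const false) (const true))).congr fun x => ?_
  cases f x <;> cases g x <;> rfl

end PolyTime
-- Symbols, binary numerals and comparison of lists
open Enc (tree)

/-- The position of a symbol in a fixed list of all symbols. -/
def gammaIndex : Γ' → ℕ
  | .blank => 0
  | .bit false => 1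
  | .bit true => 2
  | .bra => 3
  | .ket => 4
  | .comma => 5

instance : Enc Γ' := ⟨fun c => tree (gammaIndex c)⟩

theorem sz_gamma (c : Γ') : sz c = 2 * gammaIndex c + 1 := sz_nat _

theorem sz_gamma_le (c : Γ') : sz c ≤ 11 := by
  rw [sz_gamma]; rcases c with _ | (_ | _) | _ | _ | _ <;> simp [gammaIndex]

/-- Binary increment, least significant bit first. -/
def bitsSucc : List Bool → List Bool
  | [] => [true]
  | false :: l => true :: l
  | true :: l => false :: bitsSucc l

theorem encodePosNum_succ (n : PosNum) : encodePosNum n.succ = bitsSucc (encodePosNum n) := by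
  induction n with
  | one => rfl
  | bit0 n ih => rfl
  | bit1 n ih => simp [PosNum.succ, encodePosNum, bitsSucc, ih]

theorem encodeNat_succ (n : ℕ) : encodeNat (n + 1) = bitsSucc (encodeNat n) := by
  simp only [encodeNat, Nat.cast_add, Nat.cast_one, Num.add_one]
  cases (n : Num) with
  | zero => rfl
  | pos p => exact encodePosNum_succ p

theorem encodeNat_zero : encodeNat 0 = [] := rfl

theorem encodeNat_injective : Function.Injective encodeNat :=
  Function.LeftInverse.injective decode_encodeNat

theorem sz_bitsSucc_le (l : List Bool) : sz (bitsSucc l) ≤ sz l + 4 := by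
  induction l with
  | nil => decide
  | cons b l ih =>
    cases b
    · have h₁ : sz true ≤ 3 := by decide
      have h₂ := sz_pos false
      simp only [bitsSucc, sz_cons]; omega
    · simp only [bitsSucc, sz_cons]
      have : sz false ≤ sz true := by decide
      omega

namespace PolyTime

variable {α β γ δ : Type} [Enc α] [Enc β] [Enc γ] [Enc δ]

/-- The state holds the verdict so far and the part of `l₂` still to be compared. Lengths must
agree, since otherwise defaults or leftover items would go unnoticed; `decide_eq_list` tests this
separately. -/
theorem list_ext_fold {β : Type} [DecidableEq β] (l₁ l₂ : List β) (d : β) (b : Bool)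
    (h : l₁.length = l₂.length) :
    (l₁.foldl (fun (s : Bool × List β) c => (bif s.1 then decide (c = s.2.headD d) else false,
      s.2.tail)) (b, l₂)).1 = (b && decide (l₁ = l₂)) := by
  induction l₁ generalizing l₂ b with
  | nil => cases l₂ <;> simp_all
  | cons c l₁ ih =>
    cases l₂ with
    | nil => simp at h
    | cons c' l₂ =>
      rw [List.foldl_cons, ih _ _ (by simpa using h)]
      by_cases hc : c = c' <;> by_cases hl : l₁ = l₂ <;> cases b <;> simp [hc, hl]

theorem decide_eq_list [DecidableEq β] [Inhabited β] {f g : α → List β} (hf : PolyTime f)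
    (hg : PolyTime g) (hb : PolyTime (fun z : β × β => decide (z.1 = z.2))) :
    PolyTime (fun x => decide (f x = g x)) := by
  have h := foldl_of_growth (init := fun x => (true, g x)) (l := f)
    (step := fun _ (s : Bool × List β) c =>
      (bif s.1 then decide (c = s.2.headD default) else false, s.2.tail))
    (by fun_prop) hf ?_ 3 fun x b c => ?_
  · refine (decide_and (p := fun x => (f x).length = (g x).length) (by fun_prop)
      (decide_eq_bool (fst h) (const true))).congr fun x => ?_
    by_cases hl : (f x).length = (g x).length
    · rw [list_ext_fold _ _ _ _ hl]
      simp [hl]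
    · have : f x ≠ g x := fun h => hl (by rw [h])
      simp [hl, this]
  · refine pair (cond (by fun_prop) ?_ (const _)) (by fun_prop)
    exact hb.comp (f := fun z : α × (Bool × List β) × β => (z.2.2, z.2.1.2.headD default))
      (by fun_prop)
  · obtain ⟨b, l⟩ := b
    simp only [sz_pair, Polynomial.eval_ofNat]
    have h₁ := sz_bool_le (bif b then decide (c = l.headD default) else false)
    have h₂ : sz l.tail ≤ sz l := by cases l <;> simp; omega
    have := sz_pos b
    omega

@[fun_prop]
theorem decide_eq_bits {f g : α → List Bool} (hf : PolyTime f) (hg : PolyTime g) :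
    PolyTime (fun x => decide (f x = g x)) :=
  decide_eq_list hf hg (by fun_prop)

-- Folding from the right, a match resets the index to 0 and any other item increases it. An absent
-- item gets the length of the list, on which `voteEnds` relies.
@[fun_prop]
theorem idxOf_bits {f : α → List Bool} {l : α → List (List Bool)} (hf : PolyTime f)
    (hl : PolyTime l) : PolyTime (fun x => (l x).idxOf (f x)) := by
  refine (foldl_of_growth (init := fun _ => 0) (l := fun x => (l x).reverse)
    (step := fun x n c => if c = f x then 0 else n + 1) (by fun_prop) (by fun_prop) (by fun_prop)
    2 fun x b c => ?_).congr fun x => ?_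
  · split <;> simp; omega
  · rw [List.foldl_reverse]
    induction l x with
    | nil => rfl
    | cons y l ih => 
      rw [List.foldr_cons, ih, List.idxOf_cons]
      by_cases h : y = f x
      · simp [h]
      · simp [h, beq_eq_false_iff_ne.2 h]

/-- The state consists of the carry and the reversed output: with a carry, the bit is flipped and
its old value is the new carry. A carry left at the end becomes a new leading bit. -/
theorem bitsSucc_fold (l acc : List Bool) :
    let s := l.foldl (fun (s : Bool × List Bool) b =>
      bif s.1 then (b, (!b) :: s.2) else (false, b :: s.2)) (true, acc)
    (bif s.1 then true :: s.2 else s.2) = (bitsSucc l).reverse ++ acc := by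
  have key : ∀ (l acc : List Bool), l.foldl (fun (s : Bool × List Bool) b =>
      bif s.1 then (b, (!b) :: s.2) else (false, b :: s.2)) (false, acc) =
      (false, l.reverse ++ acc) := by
    intro l
    induction l with
    | nil => simp
    | cons b l ih => intro acc; simpa using ih (b :: acc)
  induction l generalizing acc with
  | nil => simp [bitsSucc]
  | cons b l ih =>
    cases b
    · simp only [List.foldl_cons, bitsSucc, cond_true, Bool.not_false, key]
      simp
    · simpa [bitsSucc] using ih (false :: acc)

@[fun_prop]
theorem not {f : α → Bool} (hf : PolyTime f) : PolyTime (fun x => !f x) :=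
  (cond hf (const false) (const true)).congr fun x => by cases f x <;> rfl

@[fun_prop]
theorem bitsSucc {f : α → List Bool} (hf : PolyTime f) : PolyTime (fun x => bitsSucc (f x)) := by
  have h := foldl_of_growth (init := fun _ => (true, ([] : List Bool))) (l := f)
    (step := fun _ (s : Bool × List Bool) b =>
      bif s.1 then (b, (!b) :: s.2) else (false, b :: s.2)) (by fun_prop) hf (by fun_prop) 7
    fun x s b => ?_
  · refine (reverse (cond (fst h) (cons (const true) (snd h)) (snd h))).congr fun x => ?_
    simp [bitsSucc_fold]
  · obtain ⟨b', l⟩ := s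
    cases b' <;> cases b <;> simp <;> have : sz false ≤ 3 := by decide
    all_goals
      have : sz true ≤ 3 := by decide
      have := sz_pos true
      have := sz_pos false
      omega

/-- Binary addition of a number in unary. -/
theorem bitsSucc_iterate {f : α → List Bool} {n : α → ℕ} (hf : PolyTime f) (hn : PolyTime n) :
    PolyTime (fun x => VoteControl.bitsSucc^[n x] (f x)) :=
  iterate_of_growth (step := fun _ => VoteControl.bitsSucc) hf hn (by fun_prop) 4
    fun x b => by simpa using sz_bitsSucc_le b

theorem bitsSucc_iterate_encodeNat (k n : ℕ) :
    VoteControl.bitsSucc^[n] (encodeNat k) = encodeNat (k + n) := by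
  induction n with
  | zero => rfl
  | succ n ih => rw [Function.iterate_succ_apply', ih, ← add_assoc, encodeNat_succ]

@[fun_prop]
theorem encodeNat {n : α → ℕ} (hn : PolyTime n) : PolyTime (fun x => encodeNat (n x)) := by
  refine (bitsSucc_iterate (f := fun _ => []) (const []) hn).congr fun x => ?_
  simpa [encodeNat_zero] using bitsSucc_iterate_encodeNat 0 (n x)

@[fun_prop]
theorem decide_eq_gamma {f g : α → Γ'} (hf : PolyTime f) (hg : PolyTime g) :
    PolyTime (fun x => decide (f x = g x)) := by
  have h : PolyTime gammaIndex := of_tree_eq fun _ => rfl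
  refine (decide_eq_nat (h.comp hf) (h.comp hg)).congr fun x => ?_
  rw [decide_eq_decide]
  rcases f x with _ | (_ | _) | _ | _ | _ <;> rcases g x with _ | (_ | _) | _ | _ | _ <;>
    simp [gammaIndex]

theorem of_bool (f : Bool → β) : PolyTime f := by
  refine (show PolyTime (fun c => bif c then f true else f false) by fun_prop).congr fun c => ?_
  cases c <;> rfl

end PolyTime
open Enc (tree)

/-! ### Reading the input and writing the output -/

namespace Prog

/-- Distinguish the top symbol of a stack. -/
def caseOn (k : Stk) (f : Γ' → Prog) : Prog :=
  .ite k (fun o => o = some .blank) (f .blank) <|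
  .ite k (fun o => o = some (.bit false)) (f (.bit false)) <|
  .ite k (fun o => o = some (.bit true)) (f (.bit true)) <|
  .ite k (fun o => o = some .bra) (f .bra) <|
  .ite k (fun o => o = some .ket) (f .ket) (f .comma)

theorem run_caseOn {k : Stk} {f : Γ' → Prog} {c : Γ'} {s s' : Store} {n : ℕ}
    (hc : (s k).head? = some c) (h : Run (f c) s s' n) :
    ∃ m ≤ n + 5, Run (caseOn k f) s s' m := by
  rcases c with _ | (_ | _) | _ | _ | _
  · exact ⟨_, by omega, .ite_true (by simp [hc]) h⟩
  · exact ⟨_, by omega, .ite_false (by simp [hc]) <| .ite_true (by simp [hc]) h⟩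
  · exact ⟨_, by omega, .ite_false (by simp [hc]) <| .ite_false (by simp [hc]) <|
      .ite_true (by simp [hc]) h⟩
  · exact ⟨_, by omega, .ite_false (by simp [hc]) <| .ite_false (by simp [hc]) <|
      .ite_false (by simp [hc]) <| .ite_true (by simp [hc]) h⟩
  · exact ⟨_, by omega, .ite_false (by simp [hc]) <| .ite_false (by simp [hc]) <|
      .ite_false (by simp [hc]) <| .ite_false (by simp [hc]) <| .ite_true (by simp [hc]) h⟩
  · exact ⟨_, le_rfl, .ite_false (by simp [hc]) <| .ite_false (by simp [hc]) <|
      .ite_false (by simp [hc]) <| .ite_false (by simp [hc]) <| .ite_false (by simp [hc]) h⟩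

theorem run_move_all_left (m a b : List Γ') :
    Run (.whl .main Option.isSome (.move .main .left)) (mk m a b []) (mk [] (m.reverse ++ a) b [])
      (2 * m.length + 1) := by
  induction m generalizing a with
  | nil => exact .whl_false rfl
  | cons x m ih =>
    exact Run.cast (.whl_true rfl (run_move x rfl (by simp)) (ih (x :: a)))
      rfl (by simp) (by simp; omega)

theorem run_move_all_main (m a b : List Γ') :
    Run (.whl .left Option.isSome (.move .left .main)) (mk m a b []) (mk (a.reverse ++ m) [] b [])
      (2 * a.length + 1) := by
  induction a generalizing m with
  | nil => exact .whl_false rfl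
  | cons x a ih =>
    exact Run.cast (.whl_true rfl (run_move x rfl (by simp)) (ih (x :: m)))
      rfl (by simp) (by simp; omega)

/-- Replace the string on the main stack by the tree that represents it. -/
def readInput : Prog :=
  .seq (.whl .main Option.isSome (.move .main .left)) <| .seq (.push .main (.bit false)) <|
    .whl .left Option.isSome <|
      caseOn .left fun c => .seq (.pop .left)
        (.seq (PolyTime.pushAll (tree c).code) (.push .main (.bit true)))

/-- The constant 21 is made up of at most 13 steps to push the tree of a symbol, a pop and a push, 5
tests of `caseOn`, and the loop test. -/
theorem run_readInput_loop (l a : List Γ') :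
    ∃ n ≤ 21 * l.length + 1, Run (.whl .left Option.isSome <|
      caseOn .left fun c => .seq (.pop .left)
        (.seq (PolyTime.pushAll (tree c).code) (.push .main (.bit true))))
      (mk (tree a).code l [] []) (mk (tree (l.reverse ++ a)).code [] [] []) n := by
  induction l generalizing a with
  | nil => exact ⟨1, by simp, .whl_false rfl⟩
  | cons c l ih =>
    obtain ⟨k, hk, h⟩ := PolyTime.does_pushAll (tree c).code (tree a).code [] l []
    have hc : (tree c).code.length ≤ 11 := sz_gamma_le c
    have h₁ : Run (.seq (.pop .left) (.seq (PolyTime.pushAll (tree c).code)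
        (.push .main (.bit true)))) (mk (tree a).code (c :: l) [] [])
        (mk (tree (c :: a)).code l [] []) (1 + (k + 1)) :=
      .seq (s₂ := mk (tree a).code l [] []) (run_pop (by simp))
        (.seq (s₂ := mk ((tree c).code ++ (tree a).code) l [] [])
          (h.cast (by simp) (by simp) rfl) (run_push (by simp [BTree.code])))
    obtain ⟨m, hm, h₂⟩ := run_caseOn (k := .left) (f := fun c => .seq (.pop .left)
        (.seq (PolyTime.pushAll (tree c).code) (.push .main (.bit true)))) (c := c) rfl h₁
    obtain ⟨n, hn, h₃⟩ := ih (c :: a)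
    refine ⟨m + n + 1, by simp; omega, Run.cast (.whl_true rfl h₂ h₃) rfl (by simp) rfl⟩

theorem run_readInput (l : List Γ') :
    ∃ n ≤ 23 * l.length + 3, Run readInput (mk l [] [] []) (mk (tree l).code [] [] []) n := by
  obtain ⟨n, hn, h⟩ := run_readInput_loop l.reverse []
  refine ⟨(2 * l.length + 1) + (1 + n), by simp at hn; omega, .seq (run_move_all_left l [] []) <|
    .seq (s₂ := mk [.bit false] l.reverse [] []) (run_push (by simp)) (h.cast rfl (by simp) rfl)⟩

/-- Replace a number `i` in unary by the `i`-th symbol of a list, on the left stack. -/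
def readSymbol : List Γ' → Prog
  | [] => .pop .main
  | c :: w => .ite .main (fun o => o = some (.bit true))
      (.seq (.pop .main) (.seq (.pop .main) (readSymbol w)))
      (.seq (.pop .main) (.push .left c))

theorem run_readSymbol {w : List Γ'} {i : ℕ} {c : Γ'} (h : w[i]? = some c) (r a : List Γ') :
    Run (readSymbol w) (mk ((tree i).code ++ r) a [] []) (mk r (c :: a) [] []) (3 * i + 3) := by
  induction w generalizing i with
  | nil => simp at h
  | cons d w ih =>
    cases i with
    | zero =>
      obtain rfl : d = c := by simpa using h
      exact .ite_false (by simp [BTree.code]) (.seq (m := 1) (n := 1) (s₂ := mk r a [] [])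
        (run_pop (by simp [BTree.code])) (run_push (by simp)))
    | succ i =>
      refine Run.cast (.ite_true (by simp [BTree.code])
        (.seq (s₂ := mk (.bit false :: ((tree i).code ++ r)) a [] []) (run_pop ?_)
        (.seq (s₂ := mk ((tree i).code ++ r) a [] []) (run_pop ?_) (ih (by simpa using h)))))
        rfl rfl (by omega) <;> simp [BTree.code]

/-- Replace the tree that represents a string by that string. -/
def writeOutput : Prog :=
  .seq (.whl .main (fun o => o = some (.bit true)) (.seq (.pop .main)
    (readSymbol [.blank, .bit false, .bit true, .bra, .ket, .comma]))) <|
  .seq (.pop .main) (.whl .left Option.isSome (.move .left .main))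

theorem run_writeOutput_loop (l a : List Γ') :
    ∃ n ≤ 20 * l.length + 1, Run (.whl .main (fun o => o = some (.bit true)) (.seq (.pop .main)
      (readSymbol [.blank, .bit false, .bit true, .bra, .ket, .comma])))
      (mk (tree l).code a [] []) (mk [.bit false] (l.reverse ++ a) [] []) n := by
  induction l generalizing a with
  | nil => exact ⟨1, by simp, .whl_false (by simp [BTree.code])⟩
  | cons c l ih =>
    obtain ⟨n, hn, h⟩ := ih (c :: a)
    have hc : [Γ'.blank, .bit false, .bit true, .bra, .ket, .comma][gammaIndex c]? = some c := by
      rcases c with _ | (_ | _) | _ | _ | _ <;> rfl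
    have hi : gammaIndex c ≤ 5 := by
      rcases c with _ | (_ | _) | _ | _ | _ <;> simp [gammaIndex]
    refine ⟨_, ?_, Run.cast (.whl_true (by simp [BTree.code])
      (.seq (s₂ := mk ((tree c).code ++ (tree l).code) a [] []) (run_pop ?_)
        (run_readSymbol hc _ a)) h) rfl ?_ rfl⟩
    · simp; omega
    · simp [BTree.code]
    · simp

theorem run_writeOutput (l : List Γ') :
    ∃ n ≤ 22 * l.length + 3,
      Run writeOutput (mk (tree l).code [] [] []) (mk l [] [] []) n := by
  obtain ⟨n, hn, h⟩ := run_writeOutput_loop l []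
  refine ⟨n + (1 + (2 * l.length + 1)), by omega, .seq h
    (.seq (s₂ := mk [] l.reverse [] []) (run_pop (by simp)) ?_)⟩
  exact (run_move_all_main [] l.reverse []).cast rfl (by simp) (by simp)

end Prog

theorem sz_string_le (l : List Γ') : sz l ≤ 12 * l.length + 1 := by
  refine (sz_le_of_forall (n := 11) fun c _ => sz_gamma_le c).trans (by omega)

open Prog in
/-- A polynomial-time function on strings yields a Turing machine. -/
theorem PolyTime.computable {F : List Γ' → List Γ'} (hF : PolyTime F) {α β : Type}
    {ea : α → List Γ'} {eb : β → List Γ'} {f : α → β} (h : ∀ x, F (ea x) = eb (f x)) :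
    Nonempty (Turing.TM2ComputableInPolyTime ea eb f) := by
  obtain ⟨P, p, hP⟩ := hF
  refine computableInPolyTime (.seq readInput (.seq P writeOutput))
    (23 * Polynomial.X + 6 + 23 * p.comp (12 * Polynomial.X + 1)) fun x => ?_
  obtain ⟨n₁, hn₁, h₁⟩ := run_readInput (ea x)
  obtain ⟨h₂, h₃⟩ := hP (ea x)
  obtain ⟨n₂, hn₂, h₂⟩ := h₂ [] [] []
  obtain ⟨n₃, hn₃, h₄⟩ := run_writeOutput (F (ea x))
  have h₅ := eval_le_eval p (sz_string_le (ea x))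
  have h₆ := length_le_sz (F (ea x))
  refine ⟨n₁ + (n₂ + n₃), ?_, ?_⟩
  · simp [Polynomial.eval_comp]
    omega
  · rw [← h]
    exact .seq h₁ (.seq (h₂.cast (by simp) (by simp) rfl) h₄)

open Enc (tree)

/-! ### Parsing and printing -/

namespace PolyTime

variable {α β γ δ : Type} [Enc α] [Enc β] [Enc γ] [Enc δ]

/-- In contrast to `iterate_of_growth`, sizes are bounded only along the actual orbit. The list
parser needs this, since the size of an item depends on the current remainder. -/
theorem iterate {init : α → β} {n : α → ℕ} {step : α → β → β}
    (hi : PolyTime init) (hn : PolyTime n)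
    (hs : PolyTime (fun z : α × β => step z.1 z.2)) (q : Polynomial ℕ)
    (hq : ∀ x j, j ≤ n x → sz ((step x)^[j] (init x)) ≤ q.eval (sz x)) :
    PolyTime (fun x => (step x)^[n x] (init x)) := by
  have key : ∀ (x : α) (l : List Unit) (b : β),
      l.foldl (fun b _ => step x b) b = (step x)^[l.length] b := by
    intro x l
    induction l with
    | nil => intro b; rfl
    | cons c l ih => intro b; exact ih _
  refine (foldl (step := fun x b _ => step x b) hi (replicate_unit hn)
    (hs.comp (f := fun z : α × β × Unit => (z.1, z.2.1)) (by fun_prop)) q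
    fun x l₁ l₂ h => ?_).congr fun x => by simp [key]
  rw [key]
  refine hq x _ ?_
  have := congrArg List.length h
  simp at this; omega

@[fun_prop]
theorem encodeList {l : α → List β} {e : β → List Γ'} (hl : PolyTime l)
    (he : PolyTime e) :
    PolyTime (fun x => encodeList e (l x)) := by
  unfold VoteControl.encodeList
  fun_prop

theorem encodeBits {l : α → List Bool} (hl : PolyTime l) :
    PolyTime (fun x => (l x).map Γ'.bit ++ [Γ'.comma]) :=
  append (map hl (f := fun _ => Γ'.bit)
    ((of_bool Γ'.bit).comp (f := fun z : α × Bool => z.2) (by fun_prop))) (const _)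

end PolyTime

/-- Some polynomial-time function reads the code of an object `x` at the beginning of a string and
returns `g x` and the remainder of the string. -/
def Parsable {α β : Type} [Enc β] (c : Code α) (g : α → β) : Prop :=
  ∃ p : List Γ' → β × List Γ', PolyTime p ∧ (∀ t, sz (p t).2 ≤ sz t) ∧
    ∀ x t, p (c.encode x ++ t) = (g x, t)

theorem sz_tail_le {α : Type} [Enc α] (l : List α) : sz l.tail ≤ sz l := by
  cases l <;> simp; omega

theorem Parsable.bool : Parsable Code.bool (fun b => b) := by
  refine ⟨fun t => (decide (t.headD .blank = .bit true), t.tail), by fun_prop, sz_tail_le, ?_⟩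
  rintro (_ | _) t <;> rfl

/-- The value is kept as bits, since in unary it could be exponentially large. The fold state holds
whether the comma has been seen, the bits read, and the symbols after the comma, the latter two
reversed. -/
theorem Parsable.nat : Parsable Code.nat encodeNat := by
  let step : Bool × List Bool × List Γ' → Γ' → Bool × List Bool × List Γ' := fun s c =>
    bif s.1 then (true, s.2.1, c :: s.2.2) else
      if c = .comma then (true, s.2.1, []) else (false, decide (c = .bit true) :: s.2.1, s.2.2)
  have hstep : PolyTime (fun t : List Γ' => t.foldl step (false, [], [])) := by
    refine PolyTime.foldl_of_growth (init := fun _ => (false, [], [])) (step := fun _ => step)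
      (by fun_prop) (by fun_prop) (by fun_prop) (Polynomial.X + 7) fun t s c => ?_
    obtain ⟨b, l, r⟩ := s
    have := sz_pos b
    have := sz_pos r
    have := sz_bool_le (decide (c = .bit true))
    have : sz true ≤ 3 := by decide
    have : sz false ≤ 3 := by decide
    cases b
    · simp only [step, cond_false]
      split <;> simp <;> omega
    · simp [step]; omega
  have hrest : ∀ (t : List Γ') s, sz (t.foldl step s).2.2 + 1 ≤ sz t + sz s.2.2 := by
    intro t
    induction t with
    | nil => intro s; simp [Nat.add_comm]
    | cons c t ih =>
      rintro ⟨b, l, r⟩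
      refine (ih _).trans ?_
      have := sz_pos r
      cases b
      · simp only [step, cond_false]
        split <;> simp <;> omega
      · simp [step]; omega
  have hdone : ∀ (t : List Γ') l r, t.foldl step (true, l, r) = (true, l, t.reverse ++ r) := by
    intro t
    induction t with
    | nil => simp
    | cons c t ih => intro l r; simpa [step] using ih l (c :: r)
  have hbits : ∀ (w : List Bool) (t : List Γ') l,
      (w.map Γ'.bit ++ Γ'.comma :: t).foldl step (false, l, []) =
        (true, w.reverse ++ l, t.reverse) := by
    intro w t
    induction w with
    | nil => intro l; simp [step, hdone]
    | cons b w ih => intro l; simpa [step] using ih (b :: l)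
  refine ⟨fun t => ((t.foldl step (false, [], [])).2.1.reverse,
    (t.foldl step (false, [], [])).2.2.reverse), by fun_prop, fun t => ?_, fun x t => ?_⟩
  · have := hrest t (false, [], [])
    rw [sz_reverse]
    simp at this; omega
  · simp [Code.nat, hbits]

theorem Parsable.pair {α β γ δ : Type} [Enc γ] [Enc δ] {a : Code α} {b : Code β} {g : α → γ}
    {h : β → δ} (ha : Parsable a g) (hb : Parsable b h) :
    Parsable (a.pair b) (fun x => (g x.1, h x.2)) := by
  obtain ⟨p, hp, hp', hp''⟩ := ha
  obtain ⟨q, hq, hq', hq''⟩ := hb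
  refine ⟨fun t => (((p t).1, (q (p t).2).1), (q (p t).2).2), by fun_prop,
    fun t => (hq' _).trans (hp' _), fun x t => ?_⟩
  simp [Code.pair, hp'', hq'']

theorem Parsable.comap {α β γ : Type} [Enc γ] {b : Code β} {h : β → γ} (hb : Parsable b h)
    (g : α → β) (hg : Function.Injective g) : Parsable (b.comap g hg) (fun x => h (g x)) := by
  obtain ⟨p, hp, hp', hp''⟩ := hb
  exact ⟨p, hp, hp', fun x t => hp'' _ _⟩

/-- The state holds whether the closing bracket has been reached, the reversed items, and the
remaining string. The bound on remainders in `Parsable`, valid also for malformed strings, keeps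
each item polynomial in the original string. -/
theorem Parsable.list {α β : Type} [Enc β] {a : Code α} {g : α → β} (ha : Parsable a g) :
    Parsable a.list (List.map g) := by
  obtain ⟨p, hp, hp', hp''⟩ := ha
  let step : Bool × List β × List Γ' → Bool × List β × List Γ' := fun s =>
    bif s.1 then s else if s.2.2.headD .blank = .bra then
      (false, (p s.2.2.tail).1 :: s.2.1, (p s.2.2.tail).2) else (true, s.2.1, s.2.2.tail)
  obtain ⟨_, q, hq⟩ := id hp
  have hbound : ∀ (S : ℕ) (s : Bool × List β × List Γ') j, sz s.2.2 ≤ S →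
      sz (step^[j] s).2.1 ≤ sz s.2.1 + j * (q.eval S + 1) ∧ sz (step^[j] s).2.2 ≤ S := by
    intro S s j hs
    induction j with
    | zero => exact ⟨by simp, hs⟩
    | succ j ih =>
      rw [Function.iterate_succ_apply']
      generalize step^[j] s = s' at ih
      obtain ⟨b, l, r⟩ := s'
      dsimp only at ih
      rw [add_mul]
      cases b
      · simp only [step, cond_false]
        split
        · have h₁ := (sz_tail_le r).trans ih.2
          have h₂ := (hq r.tail).2.trans (eval_le_eval q h₁)
          have h₃ : sz (p r.tail) = sz (p r.tail).1 + sz (p r.tail).2 + 1 := sz_pair _ _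
          exact ⟨by simp; omega, (hp' _).trans h₁⟩
        · exact ⟨by simp; omega, (sz_tail_le r).trans ih.2⟩
      · exact ⟨by simp [step]; omega, ih.2⟩
  have hstep : PolyTime (fun t : List Γ' => step^[t.length] (false, [], t)) := by
    refine PolyTime.iterate (init := fun t => (false, [], t)) (step := fun _ => step)
      (by fun_prop) (by fun_prop) (by fun_prop)
      (6 + Polynomial.X * (q + 1) + Polynomial.X) fun t j hj => ?_
    obtain ⟨h₁, h₂⟩ := hbound (sz t) (false, [], t) j le_rfl
    have h₃ := length_le_sz t
    have h₄ := Nat.mul_le_mul_right (q.eval (sz t) + 1) (hj.trans h₃)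
    generalize step^[j] (false, [], t) = s at h₁ h₂
    obtain ⟨b, l, r⟩ := s
    have := sz_bool_le b
    simp at h₁ h₂ ⊢
    omega
  have hdone : ∀ j l r, step^[j] (true, l, r) = (true, l, r) := by
    intro j l r
    exact Function.iterate_fixed rfl j
  have hlist : ∀ (w : List α) (t : List Γ') l j, w.length < j →
      step^[j] (false, l, encodeList a.encode w ++ t) = (true, (w.map g).reverse ++ l, t) := by
    intro w t
    induction w with
    | nil =>
      rintro l (_ | j) hj
      · simp at hj
      · rw [Function.iterate_succ_apply]
        have h₁ : step (false, l, encodeList a.encode [] ++ t) = (true, l, t) := by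
          simp [step, encodeList]
        rw [h₁, hdone]
        simp
    | cons x w ih =>
      rintro l (_ | j) hj
      · simp at hj
      · rw [Function.iterate_succ_apply]
        have := ih (g x :: l) j (by simpa using hj)
        simpa [step, encodeList, hp''] using this
  refine ⟨fun t => ((step^[t.length] (false, [], t)).2.1.reverse,
    (step^[t.length] (false, [], t)).2.2), by fun_prop, fun t => ?_, fun x t => ?_⟩
  · exact (hbound (sz t) (false, [], t) _ le_rfl).2
  -- One opening bracket per item and the closing one: the length of the string is enough rounds to
  -- finish.
  · have : x.length < (encodeList a.encode x ++ t).length := by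
      have : x.length ≤ (x.flatMap fun x => Γ'.bra :: a.encode x).length := by
        induction x with
        | nil => simp
        | cons y x ih => simp at ih ⊢; omega
      simp [encodeList] at this ⊢
      omega
    simp only [Code.list]
    rw [hlist _ _ _ _ this]
    simp

/-- A reduction that is computed on parsed instances. -/
theorem dttReducible_of_polyTime {X Y : DecisionProblem} {α β : Type} [Enc α] [Enc β]
    {g : X.Instance → α} (hX : Parsable X.code g) (e : β → List Γ') (he : PolyTime e)
    (F : α → List β) (hF : PolyTime F) (f : X.Instance → List Y.Instance)
    (hf : ∀ x, (f x).map Y.code.encode = (F (g x)).map e)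
    (hYes : ∀ x, X.IsYes x ↔ ∃ y ∈ f x, Y.IsYes y) : PolyTimeDTTReducible X Y := by
  obtain ⟨p, hp, -, hp'⟩ := hX
  refine ⟨f, PolyTime.computable (F := fun t => encodeList e (F (p t).1)) (by fun_prop)
    fun x => ?_, hYes⟩
  have h := hp' x []
  rw [List.append_nil] at h
  simp only [h, Code.list]
  have : ∀ {γ : Type} (e : γ → List Γ') (l : List γ), encodeList e l =
      (l.map e).flatMap (fun w => Γ'.bra :: w) ++ [Γ'.ket] := by
    intro γ e l
    simp [encodeList, List.flatMap_map]
  rw [this, this, hf]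

/-! ### Yes-instances in terms of indices -/

/-- Voters may cast equal votes, so a choice of voters is described by the set of their indices.
Only properties that depend on this set alone can be transferred. -/
theorem exists_sublist_map_iff {ι β : Type} [DecidableEq ι] {J : List ι}
    (f : ι → β) {Q : List β → Prop} {Q' : Finset ι → Prop}
    (h : ∀ l : List ι, l.Sublist J → (Q (l.map f) ↔ Q' l.toFinset)) :
    (∃ l : List β, l.Sublist (J.map f) ∧ Q l) ↔ ∃ S, S ⊆ J.toFinset ∧ Q' S := by
  constructor
  · rintro ⟨l, hl, hQ⟩
    obtain ⟨l', hl', rfl⟩ := List.sublist_map_iff.1 hl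
    exact ⟨l'.toFinset, fun i hi => List.mem_toFinset.2 (hl'.subset (List.mem_toFinset.1 hi)),
      (h _ hl').1 hQ⟩
  · rintro ⟨S, hS, hQ⟩
    refine ⟨(J.filter (· ∈ S)).map f, List.filter_sublist.map f, (h _ List.filter_sublist).2 ?_⟩
    convert hQ
    ext i
    simpa using fun hi => List.mem_toFinset.1 (hS hi)

theorem score_append (α : (m : ℕ) → Fin m → ℤ) {m : ℕ} (V W : List (Vote m)) (c : Fin m) :
    score α (V ++ W) c = score α V c + score α W c := by
  simp [score]

theorem firstLast_isYes_iff {ι : Type} [DecidableEq ι] {m : ℕ} {p : Fin m} {k : ℕ}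
    {V : List (Vote m)} {J : List ι} (hJ : J.Nodup) (f : ι → Vote m) :
    (exactCCAV firstLast).IsYes ⟨m, p, k, V, J.map f⟩ ↔ ∃ S, S ⊆ J.toFinset ∧ S.card = k ∧
      ∀ d, score firstLastVector V d + ∑ j ∈ S, firstLastVector m ((f j).symm d) ≤
        score firstLastVector V p + ∑ j ∈ S, firstLastVector m ((f j).symm p) := by
  refine exists_sublist_map_iff f fun l hl => ?_
  have hn := hl.nodup hJ
  simp only [firstLast, scoringRule, Set.mem_ofPred_eq, score_append, List.length_map,
    List.toFinset_card_of_nodup hn, List.sum_toFinset _ hn]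
  simp only [score, List.map_map, Function.comp_def]

/-- The points from a vote with first candidate `f` and last candidate `l`. -/
def points {m : ℕ} (f l c : Fin m) : ℤ := (if f = c then 1 else 0) - (if l = c then 1 else 0)

theorem sum_points {m : ℕ} (f l : Fin m) : ∑ c, points f l c = 0 := by
  simp [points]

theorem firstLastVector_symm {n : ℕ} (v : Vote (n + 1)) (c : Fin (n + 1)) :
    firstLastVector (n + 1) (v.symm c) = points (v 0) (v (Fin.last n)) c := by
  have h₁ : ((v.symm c : Fin (n + 1)) : ℕ) = 0 ↔ v 0 = c := by
    rw [Fin.val_eq_zero_iff, Equiv.symm_apply_eq, eq_comm]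
  have h₂ : ((v.symm c : Fin (n + 1)) : ℕ) + 1 = n + 1 ↔ v (Fin.last n) = c := by
    rw [← Equiv.eq_symm_apply, Fin.ext_iff, Fin.val_last]; omega
  simp only [firstLastVector, points, h₁, h₂]

theorem score_eq_sum_points {n : ℕ} (V : List (Vote (n + 1))) (c : Fin (n + 1)) :
    score firstLastVector V c = (V.map fun v => points (v 0) (v (Fin.last n)) c).sum := by
  simp [score, firstLastVector_symm]

/-! ### Perfect matchings as sets of edge indices -/

namespace RedBipartiteInstance

variable (I : RedBipartiteInstance)

/-- The left end of an edge. -/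
def src (i : Fin I.edgeList.length) : Fin I.left := I.edgeList[i].1
/-- The right end of an edge. -/
def tgt (i : Fin I.edgeList.length) : Fin I.right := I.edgeList[i].2.1
def red (i : Fin I.edgeList.length) : Bool := I.edgeList[i].2.2

theorem ends_injective : Function.Injective fun i => (I.src i, I.tgt i) := by
  intro i j h
  have := List.nodup_iff_injective_get.1 I.nodup
  have h' := @this (i.cast (by simp)) (j.cast (by simp)) (by simpa [src, tgt] using h)
  simpa [Fin.ext_iff] using h'

theorem mem_edges (e : Fin I.left × Fin I.right) : e ∈ I.edges ↔ ∃ i, (I.src i, I.tgt i) = e := by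
  rw [edges, List.mem_toFinset, List.mem_map]
  constructor
  · rintro ⟨x, hx, rfl⟩
    obtain ⟨i, rfl⟩ := List.mem_iff_get.1 hx
    exact ⟨i, rfl⟩
  · rintro ⟨i, rfl⟩
    exact ⟨_, List.getElem_mem i.2, rfl⟩

theorem mem_redEdges (e : Fin I.left × Fin I.right) :
    e ∈ I.redEdges ↔ ∃ i, I.red i ∧ (I.src i, I.tgt i) = e := by
  simp only [redEdges, List.mem_toFinset, List.mem_map, List.mem_filter]
  constructor
  · rintro ⟨x, ⟨hx, h⟩, rfl⟩
    obtain ⟨i, rfl⟩ := List.mem_iff_get.1 hx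
    exact ⟨i, h, rfl⟩
  · rintro ⟨i, h, rfl⟩
    exact ⟨_, ⟨List.getElem_mem i.2, h⟩, rfl⟩

/-- No edge is listed twice, so sets of indices and sets of edges correspond. Unique incidence
becomes a cardinality, which is what scores can count. -/
theorem isYes_iff : exactPerfectBipartiteMatching.IsYes I ↔
    ∃ T : Finset (Fin I.edgeList.length), (∀ u, {i ∈ T | I.src i = u}.card = 1) ∧
      (∀ v, {i ∈ T | I.tgt i = v}.card = 1) ∧ {i ∈ T | I.red i}.card = I.k := by
  have hred : ∀ T : Finset (Fin I.edgeList.length),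
      (T.image (fun i => (I.src i, I.tgt i)) ∩ I.redEdges).card = {i ∈ T | I.red i}.card := by
    intro T
    rw [← Finset.card_image_of_injective _ I.ends_injective]
    congr 1
    ext e
    simp only [Finset.mem_inter, Finset.mem_image, mem_redEdges, Finset.mem_filter]
    constructor
    · rintro ⟨⟨i, hi, rfl⟩, j, hj, h⟩
      obtain rfl := I.ends_injective h
      exact ⟨j, ⟨hi, hj⟩, rfl⟩
    · rintro ⟨i, ⟨hi, hi'⟩, rfl⟩
      exact ⟨⟨i, hi, rfl⟩, i, hi', rfl⟩
  have hmatch : ∀ T : Finset (Fin I.edgeList.length),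
      I.IsPerfectMatching (T.image (fun i => (I.src i, I.tgt i))) ↔
      (∀ u, {i ∈ T | I.src i = u}.card = 1) ∧ (∀ v, {i ∈ T | I.tgt i = v}.card = 1) := by
    intro T
    have key : ∀ (f : Fin I.left × Fin I.right → Prop) [DecidablePred f],
        ((∃! e, e ∈ T.image (fun i => (I.src i, I.tgt i)) ∧ f e) ↔
          {i ∈ T | f (I.src i, I.tgt i)}.card = 1) := by
      intro f _
      rw [Finset.card_eq_one]
      constructor
      · rintro ⟨e, ⟨he, hf⟩, hu⟩
        obtain ⟨i, hi, rfl⟩ := Finset.mem_image.1 he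
        refine ⟨i, Finset.ext fun j => ?_⟩
        simp only [Finset.mem_filter, Finset.mem_singleton]
        constructor
        · rintro ⟨hj, hfj⟩
          exact I.ends_injective (hu _ ⟨Finset.mem_image_of_mem _ hj, hfj⟩)
        · rintro rfl; exact ⟨hi, hf⟩
      · rintro ⟨i, hi⟩
        have h := Finset.ext_iff.1 hi
        simp only [Finset.mem_filter, Finset.mem_singleton] at h
        obtain ⟨h₁, h₂⟩ := (h i).2 rfl
        refine ⟨_, ⟨Finset.mem_image_of_mem _ h₁, h₂⟩, ?_⟩
        rintro e ⟨he, hf⟩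
        obtain ⟨j, hj, rfl⟩ := Finset.mem_image.1 he
        rw [(h j).1 ⟨hj, hf⟩]
    refine Iff.trans (and_iff_right fun e he => ?_) (and_congr ?_ ?_)
    · obtain ⟨i, -, rfl⟩ := Finset.mem_image.1 he
      exact (I.mem_edges _).2 ⟨i, rfl⟩
    · exact forall_congr' fun u => key (fun e => e.1 = u)
    · exact forall_congr' fun u => key (fun e => e.2 = u)
  constructor
  · rintro ⟨M, hM, hk⟩
    have : M = Finset.image (fun i => (I.src i, I.tgt i)) {i | (I.src i, I.tgt i) ∈ M} := by
      ext e
      simp only [Finset.mem_image, Finset.mem_filter, Finset.mem_univ, true_and]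
      constructor
      · intro he
        obtain ⟨i, rfl⟩ := (I.mem_edges _).1 (hM.1 he)
        exact ⟨i, he, rfl⟩
      · rintro ⟨i, hi, rfl⟩; exact hi
    rw [this] at hM hk
    exact ⟨_, ((hmatch _).1 hM).1, ((hmatch _).1 hM).2, by rw [← hred, hk]⟩
  · rintro ⟨T, h₁, h₂, h₃⟩
    exact ⟨_, (hmatch T).2 ⟨h₁, h₂⟩, by rw [hred, h₃]⟩

end RedBipartiteInstance
/-! ### From matchings to elections -/

/-- A vote with given first and last candidates. -/
def endsVote {n : ℕ} (c d : Fin (n + 2)) : Vote (n + 2) :=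
  (Equiv.swap 0 c).trans (Equiv.swap (Equiv.swap 0 c (Fin.last (n + 1))) d)

/-- The second transposition moves only `d` and the candidate that the first one puts last, and both
differ from `c`. -/
theorem endsVote_zero {n : ℕ} {c d : Fin (n + 2)} (h : c ≠ d) : endsVote c d 0 = c := by
  have h₁ : c ≠ Equiv.swap 0 c (Fin.last (n + 1)) := by
    rw [ne_comm, Ne, Equiv.swap_apply_eq_iff, Equiv.swap_apply_right]
    exact (Fin.last_pos).ne'
  simp [endsVote, Equiv.swap_apply_of_ne_of_ne h₁ h]

theorem endsVote_last {n : ℕ} (c d : Fin (n + 2)) : endsVote c d (Fin.last (n + 1)) = d := by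
  simp [endsVote]

def natSwap (x y i : ℕ) : ℕ := if i = x then y else if i = y then x else i

theorem val_swap {n : ℕ} (x y i : Fin n) : (Equiv.swap x y i : ℕ) = natSwap x y i := by
  simp only [Equiv.swap_apply_def, natSwap, Fin.ext_iff]
  split_ifs <;> rfl

/-- The list of candidates of `endsVote`. -/
def endsList (m c d : ℕ) : List ℕ :=
  (List.range m).map fun i => natSwap (natSwap 0 c (m - 1)) d (natSwap 0 c i)

theorem toList_endsVote {n : ℕ} (c d : Fin (n + 2)) :
    (endsVote c d).toList = endsList (n + 2) c d := by
  refine List.ext_getElem (by simp [Vote.toList, endsList]) fun i h₁ h₂ => ?_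
  simp only [Vote.toList, endsList, List.getElem_ofFn, List.getElem_map, List.getElem_range]
  simp [endsVote, val_swap]

namespace RedBipartiteInstance

variable (I : RedBipartiteInstance)

/-- The number of candidates, minus two. -/
def size : ℕ := I.left + I.right + I.edgeList.length

theorem size_eq : I.size = I.left + I.right + I.edgeList.length := rfl

def leftCand (u : Fin I.left) : Fin (I.size + 2) := ⟨u, by have := u.2; have := I.size_eq; omega⟩
def rightCand (v : Fin I.right) : Fin (I.size + 2) := ⟨I.left + v, by have := v.2; have := I.size_eq; omega⟩
/-- The middle of the path of two voters that represents a red edge. -/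
def midCand (i : Fin I.edgeList.length) : Fin (I.size + 2) :=
  ⟨I.left + I.right + i, by have := i.2; have := I.size_eq; omega⟩
/-- The candidate that balances the registered voters. -/
def balanceCand : Fin (I.size + 2) := ⟨I.size, by omega⟩
def preferredCand : Fin (I.size + 2) := Fin.last _

theorem cand_cases (d : Fin (I.size + 2)) : (∃ u, d = I.leftCand u) ∨ (∃ v, d = I.rightCand v) ∨
    (∃ i, d = I.midCand i) ∨ d = I.balanceCand ∨ d = I.preferredCand := by
  obtain ⟨d, hd⟩ := d
  have := I.size_eq
  by_cases h₁ : d < I.left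
  · exact .inl ⟨⟨d, h₁⟩, rfl⟩
  by_cases h₂ : d < I.left + I.right
  · exact .inr (.inl ⟨⟨d - I.left, by omega⟩, Fin.ext (by simp [rightCand]; omega)⟩)
  by_cases h₃ : d < I.size
  · exact .inr (.inr (.inl ⟨⟨d - (I.left + I.right), by omega⟩,
      Fin.ext (by simp [midCand]; omega)⟩))
  simp only [balanceCand, preferredCand, Fin.ext_iff, Fin.val_last]
  right; right; right; omega

/-- The first candidate of an unregistered voter. A black edge has one voter, and a red edge has
another one, marked by `true`. -/
def firstCand (j : Fin I.edgeList.length × Bool) : Fin (I.size + 2) :=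
  if j.2 then I.midCand j.1 else I.rightCand (I.tgt j.1)
def lastCand (j : Fin I.edgeList.length × Bool) : Fin (I.size + 2) :=
  if I.red j.1 ∧ ¬ j.2 then I.midCand j.1 else I.leftCand (I.src j.1)

section
attribute [local simp] leftCand rightCand midCand balanceCand preferredCand Fin.ext_iff

@[simp] theorem leftCand_inj (u v) : I.leftCand u = I.leftCand v ↔ u = v := by simp
@[simp] theorem rightCand_inj (u v) : I.rightCand u = I.rightCand v ↔ u = v := by simp
@[simp] theorem midCand_inj (u v) : I.midCand u = I.midCand v ↔ u = v := by simp
@[simp] theorem leftCand_ne_rightCand (u v) : I.leftCand u ≠ I.rightCand v := by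
  have := I.size_eq; simp; omega
@[simp] theorem leftCand_ne_midCand (u v) : I.leftCand u ≠ I.midCand v := by
  have := I.size_eq; simp; omega
@[simp] theorem leftCand_ne_balanceCand (u) : I.leftCand u ≠ I.balanceCand := by
  have := I.size_eq; simp; omega
@[simp] theorem leftCand_ne_preferredCand (u) : I.leftCand u ≠ I.preferredCand := by
  have := I.size_eq; simp; omega
@[simp] theorem rightCand_ne_midCand (u v) : I.rightCand u ≠ I.midCand v := by
  have := I.size_eq; simp; omega
@[simp] theorem rightCand_ne_balanceCand (u) : I.rightCand u ≠ I.balanceCand := by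
  have := I.size_eq; simp; omega
@[simp] theorem rightCand_ne_preferredCand (u) : I.rightCand u ≠ I.preferredCand := by
  have := I.size_eq; simp; omega
@[simp] theorem midCand_ne_balanceCand (u) : I.midCand u ≠ I.balanceCand := by
  have := I.size_eq; simp; omega
@[simp] theorem midCand_ne_preferredCand (u) : I.midCand u ≠ I.preferredCand := by
  have := I.size_eq; simp; omega
@[simp] theorem balanceCand_ne_preferredCand : I.balanceCand ≠ I.preferredCand := by simp
@[simp] theorem rightCand_ne_leftCand (u v) : I.rightCand v ≠ I.leftCand u :=
  (I.leftCand_ne_rightCand u v).symm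
@[simp] theorem midCand_ne_leftCand (u v) : I.midCand v ≠ I.leftCand u :=
  (I.leftCand_ne_midCand u v).symm
@[simp] theorem midCand_ne_rightCand (u v) : I.midCand v ≠ I.rightCand u :=
  (I.rightCand_ne_midCand u v).symm
@[simp] theorem balanceCand_ne_leftCand (u) : I.balanceCand ≠ I.leftCand u :=
  (I.leftCand_ne_balanceCand u).symm
@[simp] theorem balanceCand_ne_rightCand (u) : I.balanceCand ≠ I.rightCand u :=
  (I.rightCand_ne_balanceCand u).symm
@[simp] theorem balanceCand_ne_midCand (u) : I.balanceCand ≠ I.midCand u :=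
  (I.midCand_ne_balanceCand u).symm

end

theorem firstCand_ne_lastCand (j) : I.firstCand j ≠ I.lastCand j := by
  obtain ⟨i, _ | _⟩ := j <;> cases h : I.red i <;> simp [firstCand, lastCand, h]

/-- The unregistered voters. -/
def voters : List (Fin I.edgeList.length × Bool) :=
  (List.finRange _).flatMap fun i => if I.red i then [(i, true), (i, false)] else [(i, false)]

theorem mem_voters (j) : j ∈ I.voters ↔ (j.2 → I.red j.1) := by
  obtain ⟨i, h⟩ := j
  simp only [voters, List.mem_flatMap, List.mem_finRange, true_and]
  constructor
  · rintro ⟨i', hi⟩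
    by_cases h' : I.red i' <;> simp [h'] at hi <;> aesop
  · intro hi
    refine ⟨i, ?_⟩
    cases h <;> by_cases h' : I.red i <;> simp_all

theorem nodup_voters : I.voters.Nodup := by
  refine List.nodup_flatMap.2 ⟨fun i _ => ?_, ?_⟩
  · split <;> simp
  · refine (List.nodup_finRange _).imp ?_
    intro i j hij
    simp only [Function.onFun, List.Disjoint]
    intro x hx hy
    have h₁ : x.1 = i := by split at hx <;> simp at hx <;> aesop
    have h₂ : x.1 = j := by split at hy <;> simp at hy <;> aesop
    exact hij (h₁.symm.trans h₂)

/-- The registered voters. -/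
def registered : List (Vote (I.size + 2)) :=
  (List.finRange I.left).map (fun u => endsVote (I.leftCand u) I.balanceCand) ++
    (List.finRange I.right).map (fun v => endsVote I.balanceCand (I.rightCand v))

/-- The election of the reduction. -/
def toElection : AddingVotersInstance where
  m := I.size + 2
  p := I.preferredCand
  -- A perfect matching has as many edges as there are left vertices, and each red edge takes a
  -- second voter.
  k := I.k + I.left
  registered := I.registered
  unregistered := I.voters.map fun j => endsVote (I.firstCand j) (I.lastCand j)

/-- The scores if the voters in `S` are added. -/
def total (S : Finset (Fin I.edgeList.length × Bool)) (d : Fin (I.size + 2)) : ℤ :=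
  ∑ u, points (I.leftCand u) I.balanceCand d + ∑ v, points I.balanceCand (I.rightCand v) d +
    ∑ j ∈ S, points (I.firstCand j) (I.lastCand j) d

theorem total_eq (S : Finset (Fin I.edgeList.length × Bool)) (d : Fin (I.size + 2)) :
    score firstLastVector I.registered d + ∑ j ∈ S,
      firstLastVector (I.size + 2) ((endsVote (I.firstCand j) (I.lastCand j)).symm d) =
      I.total S d := by
  have h₁ : ∀ j, endsVote (I.firstCand j) (I.lastCand j) 0 = I.firstCand j := fun j =>
    endsVote_zero (I.firstCand_ne_lastCand j)
  simp only [registered, score_append, score_eq_sum_points, firstLastVector_symm, total, h₁,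
    endsVote_last, List.map_map]
  congr 2 <;>
  · rw [← List.ofFn_eq_map, List.sum_ofFn]
    simp [endsVote_zero, endsVote_last]

theorem toElection_isYes_iff : (exactCCAV firstLast).IsYes I.toElection ↔
    ∃ S, S ⊆ I.voters.toFinset ∧ S.card = I.k + I.left ∧
      ∀ d, I.total S d ≤ I.total S I.preferredCand := by
  refine (firstLast_isYes_iff I.nodup_voters _).trans ?_
  simp only [total_eq]

theorem sum_total (S) : ∑ d, I.total S d = 0 := by
  simp only [total, Finset.sum_add_distrib]
  rw [Finset.sum_comm, Finset.sum_comm (s := Finset.univ (α := Fin (I.size + 2))) (t := Finset.univ),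
    Finset.sum_comm (s := Finset.univ) (t := S)]
  simp [sum_points]

/-- The preferred candidate is never first or last. So it wins only if no score is positive, and by
`sum_total` all scores then vanish. -/
theorem total_preferredCand (S) : I.total S I.preferredCand = 0 := by
  have h₁ : ∀ j, I.firstCand j ≠ I.preferredCand := by intro j; unfold firstCand; split <;> simp
  have h₂ : ∀ j, I.lastCand j ≠ I.preferredCand := by intro j; unfold lastCand; split <;> simp
  simp [total, points, h₁, h₂]

theorem total_balanceCand (S) : I.total S I.balanceCand = I.right - I.left := by
  have h₁ : ∀ j, I.firstCand j ≠ I.balanceCand := by intro j; unfold firstCand; split <;> simp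
  have h₂ : ∀ j, I.lastCand j ≠ I.balanceCand := by intro j; unfold lastCand; split <;> simp
  simp [total, points, h₁, h₂]
  ring

theorem sum_voters (S : Finset (Fin I.edgeList.length × Bool))
    (f : Fin I.edgeList.length × Bool → ℤ) :
    ∑ j ∈ S, f j = ∑ i, ((if (i, true) ∈ S then f (i, true) else 0) +
      (if (i, false) ∈ S then f (i, false) else 0)) := by
  have : ∑ j ∈ S, f j = ∑ j, if j ∈ S then f j else 0 := by simp
  rw [this, Fintype.sum_prod_type]
  simp only [Fintype.sum_bool]

theorem card_filter_eq_sum {α : Type} [Fintype α] [DecidableEq α] (T : Finset α) (p : α → Prop)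
    [DecidablePred p] : ((T.filter p).card : ℤ) = ∑ i, if i ∈ T ∧ p i then 1 else 0 := by
  rw [Finset.sum_boole]
  congr 2
  ext i
  simp

/-- The voters of a set of edges. -/
def votersOf (T : Finset (Fin I.edgeList.length)) : Finset (Fin I.edgeList.length × Bool) :=
  {j | j.1 ∈ T ∧ (j.2 → I.red j.1)}

/-- If this score vanishes, the two voters of a red edge are added together or not at all, and a
black edge has no second voter in `S`; so `S` comes from a set of edges. -/
theorem total_midCand (S) (i) : I.total S (I.midCand i) =
    (if (i, true) ∈ S then 1 else 0) - (if (i, false) ∈ S ∧ I.red i then 1 else 0) := by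
  simp only [total, sum_voters]
  rw [Finset.sum_eq_single (s := Finset.univ (α := Fin I.edgeList.length)) i]
  · cases h : I.red i <;> simp [points, firstCand, lastCand, h]
    split_ifs <;> rfl
  · intro i' _ hi
    cases h : I.red i' <;> simp [points, firstCand, lastCand, h, hi]
  · simp

/-- A registered voter provides the 1. Each edge of `T` at `u` takes one point, through exactly one
of its voters. -/
theorem total_leftCand (T) (u) : I.total (I.votersOf T) (I.leftCand u) =
    1 - ({i ∈ T | I.src i = u}.card : ℤ) := by
  have : ({i ∈ T | I.src i = u}.card : ℤ) = ∑ i, if i ∈ T ∧ I.src i = u then 1 else 0 :=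
    card_filter_eq_sum _ _
  simp only [total, sum_voters, this]
  rw [sub_eq_add_neg, ← Finset.sum_neg_distrib]
  congr 1
  · simp [points]
  · refine Finset.sum_congr rfl fun i _ => ?_
    cases h : I.red i <;> simp [points, firstCand, lastCand, h, votersOf]
    all_goals by_cases h₁ : i ∈ T <;> simp [h₁]

theorem total_rightCand (T) (v) : I.total (I.votersOf T) (I.rightCand v) =
    ({i ∈ T | I.tgt i = v}.card : ℤ) - 1 := by
  have : ({i ∈ T | I.tgt i = v}.card : ℤ) = ∑ i, if i ∈ T ∧ I.tgt i = v then 1 else 0 :=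
    card_filter_eq_sum _ _
  simp only [total, sum_voters, this]
  rw [sub_eq_add_neg, add_comm]
  congr 1
  · refine Finset.sum_congr rfl fun i _ => ?_
    cases h : I.red i <;> simp [points, firstCand, lastCand, h, votersOf]
    all_goals by_cases h₁ : i ∈ T <;> simp [h₁]
  · simp [points]

theorem card_votersOf (T) : (I.votersOf T).card = {i ∈ T | I.red i}.card + T.card := by
  have h : ((I.votersOf T).card : ℤ) = ∑ j ∈ I.votersOf T, (1 : ℤ) := by simp
  have h₁ : ({i ∈ T | I.red i}.card : ℤ) = ∑ i, if i ∈ T ∧ I.red i then 1 else 0 :=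
    card_filter_eq_sum _ _
  have h₂ : (T.card : ℤ) = ∑ i, if i ∈ T then 1 else 0 := by simp
  rw [sum_voters] at h
  zify
  rw [h, h₁, h₂, ← Finset.sum_add_distrib]
  simp [votersOf]

theorem toElection_isYes :
    exactPerfectBipartiteMatching.IsYes I ↔ (exactCCAV firstLast).IsYes I.toElection := by
  rw [isYes_iff]
  refine Iff.trans ?_ I.toElection_isYes_iff.symm
  simp only [total_preferredCand]
  constructor
  · rintro ⟨T, h₁, h₂, h₃⟩
    have hT₁ : T.card = I.left := by
      rw [Finset.card_eq_sum_card_fiberwise (f := I.src) (t := Finset.univ) (by simp)]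
      simp [h₁]
    have hT₂ : T.card = I.right := by
      rw [Finset.card_eq_sum_card_fiberwise (f := I.tgt) (t := Finset.univ) (by simp)]
      simp [h₂]
    refine ⟨I.votersOf T, fun j hj => ?_, ?_, fun d => ?_⟩
    · simp only [votersOf, Finset.mem_filter] at hj
      exact List.mem_toFinset.2 ((I.mem_voters j).2 hj.2.2)
    · rw [card_votersOf, h₃, hT₁]
    · rcases I.cand_cases d with ⟨u, rfl⟩ | ⟨v, rfl⟩ | ⟨i, rfl⟩ | rfl | rfl
      · simp [total_leftCand, h₁]
      · simp [total_rightCand, h₂]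
      · simp [total_midCand, votersOf]
      · rw [total_balanceCand]; omega
      · rw [total_preferredCand]
  · rintro ⟨S, hS, hk, hd⟩
    -- The scores are nonpositive and have sum zero.
    have hz : ∀ d, I.total S d = 0 := fun d =>
      (Finset.sum_eq_zero_iff_of_nonpos (fun d _ => hd d)).1 (I.sum_total S) d (Finset.mem_univ d)
    obtain ⟨T, rfl⟩ : ∃ T, S = I.votersOf T := by
      refine ⟨({i | (i, false) ∈ S} : Finset _), ?_⟩
      ext ⟨i, b⟩
      simp only [votersOf, Finset.mem_filter, Finset.mem_univ, true_and]
      cases b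
      · simp
      · have := hz (I.midCand i)
        rw [total_midCand] at this
        by_cases h₁ : (i, true) ∈ S <;> by_cases h₂ : (i, false) ∈ S ∧ I.red i <;>
          simp_all
    have h₁ : ∀ u, {i ∈ T | I.src i = u}.card = 1 := fun u => by
      have := hz (I.leftCand u)
      rw [total_leftCand] at this
      omega
    refine ⟨T, h₁, fun v => ?_, ?_⟩
    · have := hz (I.rightCand v)
      rw [total_rightCand] at this
      omega
    · have hT₁ : T.card = I.left := by
        rw [Finset.card_eq_sum_card_fiberwise (f := I.src) (t := Finset.univ) (by simp)]
        simp [h₁]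
      rw [card_votersOf] at hk
      omega

end RedBipartiteInstance
/-! ### Computing the election from the graph -/

namespace PolyTime

variable {α β γ δ : Type} [Enc α] [Enc β] [Enc γ] [Enc δ]

@[fun_prop]
theorem natSwap {x y i : α → ℕ} (hx : PolyTime x) (hy : PolyTime y) (hi : PolyTime i) :
    PolyTime (fun z => natSwap (x z) (y z) (i z)) := by
  unfold VoteControl.natSwap
  fun_prop

@[fun_prop]
theorem endsList {m x y : α → ℕ} (hm : PolyTime m) (hx : PolyTime x) (hy : PolyTime y) :
    PolyTime (fun z => endsList (m z) (x z) (y z)) := by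
  unfold VoteControl.endsList
  fun_prop

@[fun_prop]
theorem encode_nat {n : α → ℕ} (hn : PolyTime n) : PolyTime (fun x => Code.nat.encode (n x)) :=
  encodeBits (by fun_prop)

end PolyTime

/-- Converts a binary name to a unary index without exponential cost: the index is found in the
explicit list of all names, whose length is bounded by that of the input. -/
theorem idxOf_encodeNat {n i : ℕ} (h : i < n) :
    ((List.range n).map encodeNat).idxOf (encodeNat i) = i := by
  have hn : ((List.range n).map encodeNat).Nodup := List.nodup_range.map encodeNat_injective
  have := hn.idxOf_getElem i (by simpa using h)
  simpa only [List.getElem_map, List.getElem_range] using this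

theorem map_finRange_val {α : Type} (n : ℕ) (f : ℕ → α) :
    (List.finRange n).map (fun i : Fin n => f i) = (List.range n).map f := by
  rw [← List.map_coe_finRange_eq_range, List.map_map]; rfl

theorem flatMap_finRange_val {α : Type} (n : ℕ) (f : ℕ → List α) :
    (List.finRange n).flatMap (fun i : Fin n => f i) = (List.range n).flatMap f := by
  rw [← List.map_coe_finRange_eq_range, List.flatMap_map]

/-- The data of a graph, with numbers in binary. -/
abbrev GraphData :=
  List (List Bool) × List (List Bool) × List Bool × List (List Bool × List Bool × Bool)

/-- The data of an instance of control, with `k` in binary. -/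
abbrev ElectionData := List ℕ × ℕ × List Bool × List (List ℕ) × List (List ℕ)

def ElectionData.encode (z : ElectionData) : List Γ' :=
  encodeList Code.nat.encode z.1 ++ (Code.nat.encode z.2.1 ++ (z.2.2.1.map Γ'.bit ++ [Γ'.comma] ++
    (encodeList (encodeList Code.nat.encode) z.2.2.2.1 ++
      encodeList (encodeList Code.nat.encode) z.2.2.2.2)))

theorem PolyTime.electionData_encode : PolyTime ElectionData.encode := by
  unfold ElectionData.encode
  have h := PolyTime.encodeBits (l := fun z : ElectionData => z.2.2.1) (by fun_prop)
  fun_prop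

/-- The votes of the unregistered voters for the `i`-th edge. -/
def edgeVotes (z : GraphData) (i : ℕ) : List (List ℕ) :=
  let a := z.1.length
  let n := z.1.length + z.2.1.length
  let m := n + z.2.2.2.length + 2
  let e := z.2.2.2.getD i ([], [], false)
  let u := z.1.idxOf e.1
  let v := a + z.2.1.idxOf e.2.1
  bif e.2.2 then [endsList m (n + i) u, endsList m v (n + i)] else [endsList m v u]

/-- The data have to match those of `toElection` in order as well, since codes are compared. The
number of left vertices is added to `k` by repeated binary increments. -/
def electionOfGraph (z : GraphData) : ElectionData :=
  let a := z.1.length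
  let n := a + z.2.1.length + z.2.2.2.length
  (List.range (n + 2), n + 1, bitsSucc^[a] z.2.2.1,
    (List.range a).map (fun u => endsList (n + 2) u n) ++
      (List.range z.2.1.length).map (fun v => endsList (n + 2) n (a + v)),
    (List.range z.2.2.2.length).flatMap (edgeVotes z))

theorem PolyTime.edgeVotes : PolyTime (fun z : GraphData × ℕ => edgeVotes z.1 z.2) := by
  unfold VoteControl.edgeVotes
  fun_prop

theorem PolyTime.electionOfGraph : PolyTime electionOfGraph := by
  have h₁ := PolyTime.bitsSucc_iterate (f := fun z : GraphData => z.2.2.1) (n := fun z => z.1.length)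
    (by fun_prop) (by fun_prop)
  have h₂ : PolyTime fun z : GraphData =>
      (List.range z.2.2.2.length).flatMap (VoteControl.edgeVotes z) :=
    PolyTime.flatMap (by fun_prop) PolyTime.edgeVotes
  exact pair (by fun_prop) (pair (by fun_prop) (pair h₁ (pair (by fun_prop) h₂)))

namespace RedBipartiteInstance

variable (I : RedBipartiteInstance)

def graphData : GraphData :=
  ((List.range I.left).map encodeNat, (List.range I.right).map encodeNat, encodeNat I.k,
    (List.finRange I.edgeList.length).map fun i =>
      (encodeNat (I.src i), encodeNat (I.tgt i), I.red i))

theorem parsable : Parsable RedBipartiteInstance.code graphData := by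
  have h := ((Parsable.nat.list.pair (Parsable.nat.list.pair (Parsable.nat.pair
    (Parsable.nat.pair (Parsable.nat.pair Parsable.bool)).list))).comap
      RedBipartiteInstance.toData RedBipartiteInstance.toData_injective)
  refine (congrArg (Parsable _) (funext fun I => ?_)).mpr h
  simp only [graphData, toData, List.map_map, Prod.mk.injEq, true_and]
  exact List.ext_getElem (by simp) fun i h₁ h₂ => by simp [src, tgt, red]

theorem edgeVotes_graphData (i : Fin I.edgeList.length) : edgeVotes I.graphData i =
    (if I.red i then [(i, true), (i, false)] else [(i, false)]).map
      fun j => (endsVote (I.firstCand j) (I.lastCand j)).toList := by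
  have he : I.graphData.2.2.2.getD i ([], [], false) =
      (encodeNat (I.src i), encodeNat (I.tgt i), I.red i) := by
    simp [graphData, List.getD]
  simp only [edgeVotes, he]
  simp only [graphData, idxOf_encodeNat (I.src i).2, idxOf_encodeNat (I.tgt i).2, List.length_map,
    List.length_range, List.length_finRange]
  cases h : I.red i <;> simp [toList_endsVote, firstCand, lastCand, h, leftCand, rightCand,
    midCand, size]

theorem encode_toElection :
    AddingVotersInstance.code.encode I.toElection = (electionOfGraph I.graphData).encode := by
  have he : I.graphData.2.2.2.length = I.edgeList.length := by simp [graphData]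
  have hu : I.toElection.unregistered.map Vote.toList =
      (List.range I.graphData.2.2.2.length).flatMap (edgeVotes I.graphData) := by
    rw [he, ← flatMap_finRange_val]
    simp only [toElection, voters, List.map_map, List.map_flatMap]
    refine List.flatMap_congr fun i _ => ?_
    exact (I.edgeVotes_graphData i).symm
  have hr : I.registered.map Vote.toList =
      (List.range I.left).map (fun u => endsList (I.size + 2) u I.size) ++
        (List.range I.right).map (fun v => endsList (I.size + 2) I.size (I.left + v)) := by
    rw [← map_finRange_val, ← map_finRange_val]
    simp [registered, toList_endsVote, leftCand, rightCand, balanceCand, Function.comp_def]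
  have ha : I.graphData.1.length = I.left := by simp [graphData]
  have hb : I.graphData.2.1.length = I.right := by simp [graphData]
  have hk : bitsSucc^[I.left] I.graphData.2.2.1 = encodeNat (I.k + I.left) :=
    PolyTime.bitsSucc_iterate_encodeNat _ _
  simp only [electionOfGraph, ElectionData.encode, ← hu, ha, hb, hk]
  simp only [he]
  rw [← I.size_eq, ← hr]
  rfl

end RedBipartiteInstance

/-- A many-one reduction suffices here: the list has a single member. -/
theorem matching_reducible_control :
    PolyTimeDTTReducible exactPerfectBipartiteMatching (exactCCAV firstLast) := by
  refine dttReducible_of_polyTime RedBipartiteInstance.parsable ElectionData.encode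
    PolyTime.electionData_encode (fun z => [electionOfGraph z])
    (PolyTime.cons PolyTime.electionOfGraph (PolyTime.const []))
    (fun I => [RedBipartiteInstance.toElection I])
    (fun I => congrArg (fun w => [w]) (RedBipartiteInstance.encode_toElection I))
    (fun I => (RedBipartiteInstance.toElection_isYes I).trans
      ⟨fun h => ⟨_, List.mem_singleton_self _, h⟩, ?_⟩)
  rintro ⟨y, hy, h⟩
  obtain rfl := List.mem_singleton.1 hy
  exact h

/-! ### Graphs given by the colors of pairs -/

theorem nodup_flatMap_of_tag {ι β : Type} {l : List ι} (hl : l.Nodup) {f : ι → List β}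
    (hf : ∀ i, (f i).Nodup) (tag : β → ι) (ht : ∀ i, ∀ x ∈ f i, tag x = i) :
    (l.flatMap f).Nodup := by
  refine List.nodup_flatMap.2 ⟨fun i _ => hf i, hl.imp fun {i j} hij => ?_⟩
  intro x hx hy
  exact hij ((ht i x hx).symm.trans (ht j x hy))

namespace RedBipartiteInstance

variable {L : ℕ} (k : ℕ) (col : Fin L → Fin L → Option Bool)

/-- The edges with their colors, where `none` stands for no edge. -/
def colorEdges : List (Fin L × Fin L × Bool) :=
  (List.finRange L).flatMap fun i => (List.finRange L).flatMap fun j =>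
    (col i j).toList.map fun b => (i, j, b)

theorem mem_colorEdges (i j b) : (i, j, b) ∈ colorEdges col ↔ col i j = some b := by
  simp only [colorEdges, List.mem_flatMap, List.mem_finRange, true_and, List.mem_map,
    Option.mem_toList, Prod.mk.injEq]
  constructor
  · rintro ⟨i, j, b, h, rfl, rfl, rfl⟩
    exact h
  · intro h
    exact ⟨i, j, b, h, rfl, rfl, rfl⟩

/-- The graph in which `i` and `j` are joined by an edge of the color `col i j`. -/
abbrev ofColor : RedBipartiteInstance where
  left := L
  right := L
  k := k
  edgeList := colorEdges col
  nodup := by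
    simp only [colorEdges, List.map_flatMap, List.map_map, Function.comp_def]
    refine nodup_flatMap_of_tag (List.nodup_finRange L) (fun i => ?_)
      (fun x : Fin L × Fin L => x.1) ?_
    · refine nodup_flatMap_of_tag (List.nodup_finRange L) (fun j => ?_)
        (fun x : Fin L × Fin L => x.2) ?_
      · cases col i j <;> simp
      · rintro j x hx
        obtain ⟨b, -, rfl⟩ := List.mem_map.1 hx
        rfl
    · rintro i x hx
      obtain ⟨j, -, hx⟩ := List.mem_flatMap.1 hx
      obtain ⟨b, -, rfl⟩ := List.mem_map.1 hx
      rfl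

theorem mem_edges_ofColor (i j : Fin L) : (i, j) ∈ (ofColor k col).edges ↔ col i j ≠ none := by
  rw [edges, List.mem_toFinset, List.mem_map]
  constructor
  · rintro ⟨⟨i', j', b⟩, h, h'⟩
    obtain ⟨rfl, rfl⟩ := Prod.mk.inj h'
    rw [(mem_colorEdges col _ _ b).1 h]
    simp
  · intro h
    obtain ⟨b, hb⟩ := Option.ne_none_iff_exists'.1 h
    exact ⟨(i, j, b), (mem_colorEdges col _ _ _).2 hb, rfl⟩

theorem mem_redEdges_ofColor (i j : Fin L) :
    (i, j) ∈ (ofColor k col).redEdges ↔ col i j = some true := by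
  rw [redEdges, List.mem_toFinset, List.mem_map]
  constructor
  · rintro ⟨⟨i', j', b⟩, h, h'⟩
    obtain ⟨rfl, rfl⟩ := Prod.mk.inj h'
    obtain ⟨h₁, h₂⟩ := List.mem_filter.1 h
    rw [(mem_colorEdges col _ _ b).1 h₁]
    simpa using h₂
  · intro h
    exact ⟨(i, j, true), List.mem_filter.2 ⟨(mem_colorEdges col _ _ _).2 h, rfl⟩, rfl⟩

/-- As the parts have equal size, a perfect matching is the graph of a permutation: the left
condition yields a function, the right one its injectivity, and finiteness gives bijectivity. -/
theorem ofColor_isYes_iff : exactPerfectBipartiteMatching.IsYes (ofColor k col) ↔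
    ∃ π : Equiv.Perm (Fin L), (∀ i, col i (π i) ≠ none) ∧
      {i | col i (π i) = some true}.ncard = k := by
  have hcard : ∀ (M : Finset (Fin L × Fin L)) (π : Equiv.Perm (Fin L)),
      (∀ i j, (i, j) ∈ M ↔ π i = j) →
      (M ∩ (ofColor k col).redEdges).card = {i | col i (π i) = some true}.ncard := by
    intro M π hM
    rw [← Set.ncard_coe_finset]
    symm
    refine Set.ncard_congr (fun i _ => (i, π i)) ?_ ?_ ?_
    · intro i hi
      simp only [Finset.coe_inter, Set.mem_inter_iff, Finset.mem_coe]
      exact ⟨(hM _ _).2 rfl, (mem_redEdges_ofColor k col _ _).2 hi⟩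
    · intro i j _ _ h
      exact (Prod.mk.inj h).1
    · rintro ⟨i, j⟩ h
      simp only [Finset.coe_inter, Set.mem_inter_iff, Finset.mem_coe] at h
      obtain rfl := (hM i j).1 h.1
      exact ⟨i, (mem_redEdges_ofColor k col _ _).1 h.2, rfl⟩
  constructor
  · rintro ⟨M, ⟨hM, hl, hr⟩, hk⟩
    have hl' : ∀ i : Fin L, ∃ j : Fin L, ∀ j', (i, j') ∈ M ↔ j = j' := by
      intro i
      obtain ⟨⟨i', j⟩, ⟨h₁, h₂⟩, h₃⟩ := hl i
      obtain rfl : i' = i := h₂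
      refine ⟨j, fun j' => ⟨fun h => ?_, fun h => h ▸ h₁⟩⟩
      exact (Prod.mk.inj (h₃ (i', j') ⟨h, rfl⟩)).2.symm
    choose f hf using hl'
    have hinj : Function.Injective f := by
      intro i i' h
      obtain ⟨e, -, h₃⟩ := hr (f i)
      have h₁ := h₃ (i, f i) ⟨(hf i _).2 rfl, rfl⟩
      have h₂ := h₃ (i', f i') ⟨(hf i' _).2 rfl, h.symm⟩
      exact (Prod.mk.inj (h₁.trans h₂.symm)).1
    refine ⟨Equiv.ofBijective f (Finite.injective_iff_bijective.1 hinj), fun i => ?_, ?_⟩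
    · exact (mem_edges_ofColor k col _ _).1 (hM ((hf i _).2 rfl))
    · rw [← hcard M _ hf]
      exact hk
  · rintro ⟨π, hπ, hk⟩
    have hM : ∀ i j, (i, j) ∈ Finset.univ.image (fun i => (i, π i)) ↔ π i = j := by
      intro i j
      simp
    refine ⟨Finset.univ.image fun i => (i, π i), ⟨?_, fun i => ?_, fun j => ?_⟩, ?_⟩
    · rintro ⟨i, j⟩ h
      obtain rfl := (hM i j).1 h
      exact (mem_edges_ofColor k col _ _).2 (hπ i)
    · refine ⟨(i, π i), ⟨(hM _ _).2 rfl, rfl⟩, ?_⟩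
      rintro ⟨i', j⟩ ⟨h₁, h₂⟩
      obtain rfl : i' = i := h₂
      rw [(hM _ _).1 h₁]
    · refine ⟨(π.symm j, j), ⟨(hM _ _).2 (π.apply_symm_apply j), rfl⟩, ?_⟩
      rintro ⟨i, j'⟩ ⟨h₁, h₂⟩
      obtain rfl : j' = j := h₂
      rw [← (hM _ _).1 h₁, π.symm_apply_apply]
    · rw [hcard _ _ hM]
      exact hk

/-- A graph whose vertices are listed by `J` on both sides. -/
theorem ofColor_isYes_iff_of_list {Θ : Type} {J : List Θ} (hJ : J.Nodup)
    (hJ' : ∀ x, x ∈ J) (c : Θ → Θ → Option Bool) :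
    exactPerfectBipartiteMatching.IsYes (ofColor k fun i j : Fin J.length => c J[i] J[j]) ↔
      ∃ π : Equiv.Perm Θ, (∀ x, c x (π x) ≠ none) ∧ {x | c x (π x) = some true}.ncard = k := by
  classical
  let a : Fin J.length ≃ Θ := hJ.getEquivOfForallMemList J hJ'
  have ha : ∀ (π : Equiv.Perm (Fin J.length)) i,
      c (a i) (a.permCongr π (a i)) = c J[i] J[π i] := by
    intro π i
    rw [Equiv.permCongr_apply, Equiv.symm_apply_apply]
    rfl
  have key : ∀ π : Equiv.Perm (Fin J.length), {x | c x (a.permCongr π x) = some true} =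
      a '' {i | c J[i] J[π i] = some true} := by
    intro π
    ext x
    obtain ⟨i, rfl⟩ := a.surjective x
    rw [a.injective.mem_set_image, Set.mem_ofPred_eq, Set.mem_ofPred_eq, ha]
  rw [ofColor_isYes_iff]
  constructor
  · rintro ⟨π, h₁, h₂⟩
    refine ⟨a.permCongr π, fun x => ?_, ?_⟩
    · obtain ⟨i, rfl⟩ := a.surjective x
      rw [ha]
      exact h₁ i
    · rw [key, Set.ncard_image_of_injective _ a.injective, h₂]
  · rintro ⟨π, h₁, h₂⟩
    obtain ⟨π, rfl⟩ := a.permCongr.surjective π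
    refine ⟨π, fun i => ?_, ?_⟩
    · rw [← ha]
      exact h₁ (a i)
    · rw [← h₂, key, Set.ncard_image_of_injective _ a.injective]

end RedBipartiteInstance

/-- Two functions whose fibres have the same size differ by a bijection. -/
theorem exists_equiv_of_card_fiber {α β γ : Type} [Fintype α] [Fintype β] [DecidableEq γ]
    (f : α → γ) (g : β → γ)
    (h : ∀ c, Fintype.card {x // f x = c} = Fintype.card {y // g y = c}) :
    ∃ e : α ≃ β, ∀ x, g (e x) = f x := by
  refine ⟨(Equiv.sigmaFiberEquiv f).symm.trans ((Equiv.sigmaCongrRight fun c =>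
    Fintype.equivOfCardEq (h c)).trans (Equiv.sigmaFiberEquiv g)), fun x => ?_⟩
  exact (Fintype.equivOfCardEq (h (f x)) ⟨x, rfl⟩).2

/-! ### Adding voters as a matching problem -/

/-- A function to a finite type with prescribed sizes of the fibres. -/
theorem exists_card_fiber {δ γ : Type} [Fintype δ] [Fintype γ] [DecidableEq γ] (r : γ → ℕ)
    (h : Fintype.card δ = ∑ c, r c) : ∃ g : δ → γ, ∀ c, Fintype.card {x // g x = c} = r c := by
  have e : δ ≃ (c : γ) × Fin (r c) := Fintype.equivOfCardEq (by simpa using h)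
  refine ⟨fun x => (e x).1, fun c => ?_⟩
  rw [Fintype.card_congr (e.subtypeEquiv (q := fun y => y.1 = c) fun x => Iff.rfl),
    Fintype.card_congr (Equiv.sigmaSubtype c)]
  simp

theorem sum_card_fiber {α γ : Type} [Fintype α] [Fintype γ] [DecidableEq γ] (f : α → γ) :
    ∑ c, Fintype.card {x // f x = c} = Fintype.card α := by
  rw [← Fintype.card_sigma, Fintype.card_congr (Equiv.sigmaFiberEquiv f)]

namespace Flow

variable {υ ω C : Type} [DecidableEq C] (first last : υ ⊕ ω → C) (p : C) (s : ℕ)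

/-- The candidate on whose account the right vertex stands. -/
def owner : (υ ⊕ ω) ⊕ (C × Fin s) → C := Sum.elim last Prod.fst

/-- The color of an edge from a left vertex to a right vertex that belongs to the candidate `o`. -/
def color : (υ ⊕ ω) ⊕ (C × Fin s) → C → Option Bool
  | .inl (.inl v), o => if o = first (.inl v) then some false else none
  | .inl (.inr w), o => if o = first (.inr w) then some true else
      if o = last (.inr w) then some false else none
  | .inr _, o => if o = p then none else some false

/-- The candidate that the voter supports if the voters in `S` are added. -/
def target [DecidableEq ω] (S : Finset ω) : υ ⊕ ω → C
  | .inl v => first (.inl v)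
  | .inr w => if w ∈ S then first (.inr w) else last (.inr w)


theorem color_eq_some_true {x : (υ ⊕ ω) ⊕ (C × Fin s)} {o : C} :
    color first last p s x o = some true ↔ ∃ w, x = .inl (.inr w) ∧ o = first (.inr w) := by
  rcases x with (v | w) | d <;> simp only [color] <;> split_ifs <;> simp_all

variable [Fintype υ] [Fintype ω] [Fintype C]

theorem card_owner (c : C) : Fintype.card {y // owner last s y = c} =
    Fintype.card {u // last u = c} + s := by
  rw [Fintype.card_congr (Equiv.subtypeSum (p := fun y => owner last s y = c)), Fintype.card_sum]
  congr 1
  let e : {d : C × Fin s // d.1 = c} ≃ Fin s :=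
    ⟨fun d => d.1.2, fun i => ⟨(c, i), rfl⟩, fun ⟨⟨_, _⟩, h⟩ => by subst h; rfl, fun _ => rfl⟩
  exact (Fintype.card_congr e).trans (Fintype.card_fin s)

/-- Given a matching, `S` consists of the unregistered voters matched to their first candidate. The
supporters of `c` inject into its vertices; for `p` this is onto because no filler can be matched
there. Conversely, the fillers use up the remaining vertices, of which `p` has none. By `hne` the
color of a matching edge shows whether the voter is added. -/
theorem exists_perm_iff [DecidableEq ω] (hne : ∀ u, first u ≠ last u) (k : ℕ) :
    (∃ π : Equiv.Perm ((υ ⊕ ω) ⊕ (C × Fin s)),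
      (∀ x, color first last p s x (owner last s (π x)) ≠ none) ∧
        {x | color first last p s x (owner last s (π x)) = some true}.ncard = k) ↔
    ∃ S : Finset ω, S.card = k ∧
      (∀ c, Fintype.card {u // target first last S u = c} ≤
        Fintype.card {u // last u = c} + s) ∧
      Fintype.card {u // target first last S u = p} = Fintype.card {u // last u = p} + s := by
  have hred : ∀ (π : Equiv.Perm ((υ ⊕ ω) ⊕ (C × Fin s))) (S : Finset ω),
      (∀ w, w ∈ S ↔ owner last s (π (.inl (.inr w))) = first (.inr w)) →
      {x | color first last p s x (owner last s (π x)) = some true}.ncard = S.card := by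
    intro π S hS
    rw [← Set.ncard_coe_finset, ← Set.ncard_image_of_injective (S : Set ω)
      (Sum.inl_injective.comp Sum.inr_injective : Function.Injective fun w =>
        (.inl (.inr w) : (υ ⊕ ω) ⊕ (C × Fin s)))]
    congr 1
    ext x
    simp only [Set.mem_ofPred_eq, color_eq_some_true, Set.mem_image, Finset.mem_coe, hS]
    constructor
    · rintro ⟨w, rfl, h⟩
      exact ⟨w, h, rfl⟩
    · rintro ⟨w, h, rfl⟩
      exact ⟨w, rfl, h⟩
  constructor
  · rintro ⟨π, hπ, hk⟩
    let S : Finset ω := {w | owner last s (π (.inl (.inr w))) = first (.inr w)}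
    have hS : ∀ w, w ∈ S ↔ owner last s (π (.inl (.inr w))) = first (.inr w) := by simp [S]
    have ht : ∀ u, owner last s (π (.inl u)) = target first last S u := by
      intro u
      have := hπ (.inl u)
      rcases u with v | w
      · simpa [color, target] using this
      · simp only [target, hS]
        simp only [color] at this
        split_ifs at this ⊢ <;> simp_all
    refine ⟨S, (hred π S hS).symm.trans hk, fun c => ?_, ?_⟩
    · rw [← card_owner]
      refine Fintype.card_le_of_injective (fun u => ⟨π (.inl u.1), (ht _).trans u.2⟩) ?_
      intro u u' h
      exact Subtype.ext (Sum.inl_injective (π.injective (congrArg Subtype.val h)))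
    · rw [← card_owner]
      refine Fintype.card_of_bijective
        (f := fun u => ⟨π (.inl u.1), (ht _).trans u.2⟩) ⟨?_, ?_⟩
      · intro u u' h
        exact Subtype.ext (Sum.inl_injective (π.injective (congrArg Subtype.val h)))
      · rintro ⟨y, hy⟩
        obtain ⟨x, rfl⟩ := π.surjective y
        rcases x with u | d
        · exact ⟨⟨u, (ht u).symm.trans hy⟩, rfl⟩
        · exact absurd (hπ (.inr d)) (by simp [color, hy])
  · rintro ⟨S, hk, hle, hp⟩
    -- Each candidate receives as many fillers as it has vertices left. The numbers add up because
    -- every voter has one last candidate and one target.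
    obtain ⟨g, hg⟩ := exists_card_fiber (δ := C × Fin s) (fun c =>
      Fintype.card {u // last u = c} + s - Fintype.card {u // target first last S u = c}) (by
        have h₁ := sum_card_fiber last
        have h₂ := sum_card_fiber (target first last S)
        rw [Finset.sum_tsub_distrib _ fun c _ => hle c, Finset.sum_add_distrib, h₁, h₂]
        simp)
    obtain ⟨π, hπ⟩ := exists_equiv_of_card_fiber (Sum.elim (target first last S) g)
      (owner last s) fun c => by
        rw [Fintype.card_congr (Equiv.subtypeSum (p := fun x => Sum.elim _ g x = c)),
          Fintype.card_sum, card_owner]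
        change Fintype.card {u // target first last S u = c} + Fintype.card {d // g d = c} = _
        rw [hg, Nat.add_sub_of_le (hle c)]
    refine ⟨π, fun x => ?_, ?_⟩
    · rw [hπ]
      rcases x with (v | w) | d
      · simp [color, target]
      · by_cases h : w ∈ S <;> simp [color, target, h, (hne _).symm]
      · have : g d ≠ p := by
          intro h
          have := hg p
          rw [hp, Nat.sub_self, Fintype.card_eq_zero_iff] at this
          exact this.elim ⟨d, h⟩
        simp [color, this]
    · rw [hred π S fun w => ?_, hk]
      by_cases h : w ∈ S <;> simp [hπ, target, h, (hne _).symm]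

end Flow

/-! ### The graphs for an instance of control -/

theorem points_castSucc {m : ℕ} (a b c : Fin m) :
    points a.castSucc b.castSucc c.castSucc = points a b c := by
  simp [points]

theorem points_castSucc_last {m : ℕ} (a b : Fin m) :
    points a.castSucc b.castSucc (Fin.last m) = 0 := by
  simp [points, (Fin.castSucc_lt_last _).ne]

theorem points_nonneg {m : ℕ} {a b c : Fin m} (h : b ≠ c) : 0 ≤ points a b c := by
  unfold points
  split_ifs <;> simp_all

namespace Flow

variable {υ ω : Type} [Fintype υ] {n : ℕ}
  (first last : υ ⊕ ω → Fin n)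

/-- The score of `c` if the voters in `S` are added. -/
def total (S : Finset ω) (c : Fin n) : ℤ :=
  ∑ v, points (first (.inl v)) (last (.inl v)) c +
    ∑ w ∈ S, points (first (.inr w)) (last (.inr w)) c

theorem sum_total (S : Finset ω) : ∑ c, total first last S c = 0 := by
  simp only [total, Finset.sum_add_distrib]
  rw [Finset.sum_comm, Finset.sum_comm (s := Finset.univ) (t := S)]
  simp [sum_points]

variable [Fintype ω] [DecidableEq ω]

/-- A registered or added voter contributes its points to the difference; for any other voter the
target is the last candidate and the contribution cancels. -/
theorem card_target (S : Finset ω) (c : Fin n) :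
    (Fintype.card {u // target first last S u = c} : ℤ) =
      Fintype.card {u // last u = c} + total first last S c := by
  have h : ∀ f : υ ⊕ ω → Fin n,
      (Fintype.card {u // f u = c} : ℤ) = ∑ u, if f u = c then 1 else 0 := by
    intro f
    rw [Fintype.card_subtype]
    simp
  have hS : ∀ f : ω → ℤ, ∑ w ∈ S, f w = ∑ w, if w ∈ S then f w else 0 := by simp
  rw [h, h, total, hS, Fintype.sum_sum_type, Fintype.sum_sum_type, add_add_add_comm,
    ← Finset.sum_add_distrib, ← Finset.sum_add_distrib]
  congr 1 <;> refine Finset.sum_congr rfl fun u _ => ?_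
  · by_cases hu : first (.inl u) = c <;> simp [target, points, hu]
  · by_cases hu : u ∈ S <;> simp [target, points, hu]

/-- The witness `s` is the score of `p`, which is nonnegative because a maximum of numbers with sum
zero cannot be negative. -/
theorem exists_total_iff (p : Fin n) (S : Finset ω) :
    (∃ s ∈ List.range (Fintype.card υ + Fintype.card ω + 1),
      (∀ c, Fintype.card {u // target first last S u = c} ≤
        Fintype.card {u // last u = c} + s) ∧
      Fintype.card {u // target first last S u = p} = Fintype.card {u // last u = p} + s) ↔
    ∀ c, total first last S c ≤ total first last S p := by
  have h := card_target first last S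
  constructor
  · rintro ⟨s, -, h₁, h₂⟩ c
    have := h c
    have := h p
    have := h₁ c
    omega
  · intro hle
    have hp : 0 ≤ total first last S p := by
      by_contra! hneg
      have := Finset.sum_neg (s := Finset.univ) (f := total first last S)
        (fun c _ => (hle c).trans_lt hneg) ⟨p, Finset.mem_univ _⟩
      rw [sum_total] at this
      exact this.false
    obtain ⟨s, hs⟩ := Int.eq_ofNat_of_zero_le hp
    refine ⟨s, ?_, fun c => ?_, ?_⟩
    -- The score of `p` is at most the number of its supporters, hence at most the number of voters.
    · have h₁ := Fintype.card_subtype_le fun u => target first last S u = p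
      rw [Fintype.card_sum] at h₁
      have := h p
      rw [List.mem_range]
      omega
    · have := h c
      have := hle c
      omega
    · have := h p
      omega

end Flow

/-! ### The ends of votes, with an additional candidate -/

namespace AddingVotersInstance

variable (I : AddingVotersInstance)

/-- The first candidate of a vote. -/
def firstOf (v : Vote I.m) : Fin (I.m + 1) := (v ⟨0, I.p.pos⟩).castSucc

/-- The last candidate of a vote; an additional candidate takes this place
in an election with a single candidate. -/
def lastOf (v : Vote I.m) : Fin (I.m + 1) :=
  if I.m = 1 then Fin.last I.m else (v ⟨I.m - 1, Nat.sub_lt I.p.pos one_pos⟩).castSucc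

theorem firstOf_ne_lastOf (v : Vote I.m) : I.firstOf v ≠ I.lastOf v := by
  have := I.p.pos
  unfold firstOf lastOf
  split_ifs with h
  · exact (Fin.castSucc_lt_last _).ne
  · intro h'
    have := Fin.mk.inj (v.injective (Fin.castSucc_injective _ h'))
    omega

abbrev Voter := Fin I.registered.length ⊕ Fin I.unregistered.length

def vote : I.Voter → Vote I.m := Sum.elim (fun i => I.registered[i]) fun i => I.unregistered[i]

def first (u : I.Voter) : Fin (I.m + 1) := I.firstOf (I.vote u)

def last (u : I.Voter) : Fin (I.m + 1) := I.lastOf (I.vote u)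

/-- The additional candidate ensures that the ends of a vote differ. With at least two original
candidates it has score 0, which never exceeds a maximum of numbers with sum zero. With one it
collects all last places and cannot beat `p`. -/
theorem isYes_iff : (exactCCAV firstLast).IsYes I ↔
    ∃ S : Finset (Fin I.unregistered.length), S.card = I.k ∧
      ∀ c, Flow.total I.first I.last S c ≤ Flow.total I.first I.last S I.p.castSucc := by
  have hW : (List.finRange I.unregistered.length).map (fun i => I.unregistered[i]) =
      I.unregistered := by
    simp
  have hyes := firstLast_isYes_iff (p := I.p) (k := I.k) (V := I.registered)
    (List.nodup_finRange _) (fun i : Fin I.unregistered.length => I.unregistered[i])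
  rw [hW] at hyes
  refine hyes.trans (exists_congr fun S => ?_)
  refine (and_iff_right fun i _ => List.mem_toFinset.2 (List.mem_finRange i)).trans ?_
  refine and_congr_right fun _ => ?_
  clear hW hyes
  obtain ⟨m, p, k, V, W⟩ := I
  obtain ⟨n, rfl⟩ : ∃ n, m = n + 1 := ⟨m - 1, by have := p.pos; omega⟩
  have hV : ∀ c, score firstLastVector V c =
      ∑ v : Fin V.length, points (V[v] 0) (V[v] (Fin.last n)) c := by
    intro c
    rw [score_eq_sum_points, ← List.sum_ofFn]
    congr 1
    exact List.ext_getElem (by simp) (by simp)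
  simp only [hV, firstLastVector_symm]
  rcases n with _ | n
  -- With a single original candidate both sides hold: `p` has a nonnegative score and the
  -- additional candidate its negative.
  · refine iff_of_true (fun d => by rw [Subsingleton.elim (α := Fin 1) d p]) fun c => ?_
    have hp : p.castSucc = 0 := Fin.ext (by simp)
    rw [hp]
    have h₀ : 0 ≤ Flow.total (first ⟨_, p, k, V, W⟩) (last ⟨_, p, k, V, W⟩) S 0 := by
      have hpos : ∀ u, 0 ≤ points (first ⟨_, p, k, V, W⟩ u) (last ⟨_, p, k, V, W⟩ u) 0 := by
        intro u
        refine points_nonneg ?_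
        unfold last lastOf
        rw [if_pos rfl]
        exact Fin.zero_ne_one.symm
      exact add_nonneg (Finset.sum_nonneg fun u _ => hpos _) (Finset.sum_nonneg fun u _ => hpos _)
    have h₁ := Flow.sum_total (first ⟨_, p, k, V, W⟩) (last ⟨_, p, k, V, W⟩) S
    rw [Fin.sum_univ_two] at h₁
    match c with
    | 0 => rfl
    | 1 => omega
  · have hlast : ∀ u, last ⟨_, p, k, V, W⟩ u =
        (vote ⟨_, p, k, V, W⟩ u (Fin.last (n + 1))).castSucc := by
      intro u
      unfold last lastOf
      rw [if_neg (Nat.succ_succ_ne_one n)]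
      rfl
    have hfirst : ∀ u, first ⟨_, p, k, V, W⟩ u = (vote ⟨_, p, k, V, W⟩ u 0).castSucc :=
      fun u => rfl
    have h₁ : ∀ c, Flow.total (first ⟨_, p, k, V, W⟩) (last ⟨_, p, k, V, W⟩) S c.castSucc =
        ∑ v : Fin V.length, points (V[v] 0) (V[v] (Fin.last (n + 1))) c +
          ∑ w ∈ S, points (W[w] 0) (W[w] (Fin.last (n + 1))) c := by
      intro c
      simp only [Flow.total, hlast, hfirst, points_castSucc]
      rfl
    have h₂ : Flow.total (first ⟨_, p, k, V, W⟩) (last ⟨_, p, k, V, W⟩) S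
        (Fin.last (n + 2)) = 0 := by
      simp only [Flow.total, hlast, hfirst, points_castSucc_last, Finset.sum_const_zero, add_zero]
    have h₃ := Flow.sum_total (first ⟨_, p, k, V, W⟩) (last ⟨_, p, k, V, W⟩) S
    rw [Fin.sum_univ_castSucc, h₂, add_zero] at h₃
    simp only [← h₁]
    refine ⟨fun h => Fin.lastCases ?_ h, fun h d => h d.castSucc⟩
    rw [h₂]
    by_contra! hneg
    have := Finset.sum_neg (s := Finset.univ) (fun c _ => (h c).trans_lt hneg) ⟨p, Finset.mem_univ _⟩
    exact (h₃ ▸ this).false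

end AddingVotersInstance

theorem getElem_of_getD {α : Type} {l : List α} {i : ℕ} (h : i < l.length) (d : α) :
    l.getD i d = l[i] := by simp [h]

/-! ### The graphs for all possible winning scores -/

namespace AddingVotersInstance

variable (I : AddingVotersInstance) (s : ℕ)

/-- The vertices on either side of the graph for the score `s`. -/
abbrev Vertex := I.Voter ⊕ (Fin (I.m + 1) × Fin s)

def vertices : List (I.Vertex s) :=
  ((List.finRange I.registered.length).map fun i => .inl (.inl i)) ++
    (((List.finRange I.unregistered.length).map fun i => .inl (.inr i)) ++
      (List.finRange (I.m + 1)).flatMap fun c => (List.finRange s).map fun i => .inr (c, i))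

theorem mem_vertices (x : I.Vertex s) : x ∈ I.vertices s := by
  rcases x with (i | i) | ⟨c, i⟩ <;> simp [vertices]

theorem nodup_vertices : (I.vertices s).Nodup := by
  refine List.Nodup.append ?_ (List.Nodup.append ?_ ?_ ?_) ?_
  · exact (List.nodup_finRange _).map (Sum.inl_injective.comp Sum.inl_injective)
  · exact (List.nodup_finRange _).map (Sum.inl_injective.comp Sum.inr_injective)
  · refine nodup_flatMap_of_tag (List.nodup_finRange _)
      (fun c => (List.nodup_finRange _).map fun i j h => ?_)
      (Sum.elim (fun _ => 0) Prod.fst) fun c x hx => ?_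
    · exact (Prod.mk.inj (Sum.inr_injective h)).2
    · obtain ⟨i, -, rfl⟩ := List.mem_map.1 hx
      rfl
  · intro x hx hy
    simp only [List.mem_map, List.mem_flatMap] at hx hy
    obtain ⟨i, -, rfl⟩ := hx
    simp at hy
  · intro x hx hy
    simp only [List.mem_map, List.mem_flatMap, List.mem_append] at hx hy
    obtain ⟨i, -, rfl⟩ := hx
    simp at hy

/-- The colors of the pairs of vertices. -/
def color (x y : I.Vertex s) : Option Bool :=
  Flow.color I.first I.last I.p.castSucc s x (Flow.owner I.last s y)

/-- The graph that has a perfect matching with `k` red edges if one can add `k` voters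
such that `p` wins with the score `s`. -/
def toGraph : RedBipartiteInstance :=
  RedBipartiteInstance.ofColor I.k fun i j : Fin (I.vertices s).length =>
    I.color s (I.vertices s)[i] (I.vertices s)[j]

def toGraphs : List RedBipartiteInstance :=
  (List.range (I.registered.length + I.unregistered.length + 1)).map I.toGraph

theorem isYes_iff_exists_toGraphs : (exactCCAV firstLast).IsYes I ↔
    ∃ G ∈ I.toGraphs, exactPerfectBipartiteMatching.IsYes G := by
  have h : ∀ s, exactPerfectBipartiteMatching.IsYes (I.toGraph s) ↔ _ := fun s =>
    (RedBipartiteInstance.ofColor_isYes_iff_of_list I.k (I.nodup_vertices s)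
      (I.mem_vertices s) (I.color s)).trans
    (Flow.exists_perm_iff I.first I.last I.p.castSucc s
      (fun u => I.firstOf_ne_lastOf (I.vote u)) I.k)
  rw [isYes_iff]
  simp only [← Flow.exists_total_iff, Fintype.card_fin]
  constructor
  · rintro ⟨S, hS, s, hs, h'⟩
    exact ⟨_, List.mem_map_of_mem hs, (h s).2 ⟨S, hS, h'⟩⟩
  · rintro ⟨_, hG, h'⟩
    obtain ⟨s, hs, rfl⟩ := List.mem_map.1 hG
    obtain ⟨S, hS, h'⟩ := (h s).1 h'
    exact ⟨S, hS, s, hs, h'⟩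

end AddingVotersInstance

/-! ### Computing the graphs -/

/-- The colors of a pair as a list with at most one element. The type of a left vertex is
`0` for a registered voter, `1` for an unregistered voter, and `2` otherwise. -/
def colorList (p : ℕ) (x : ℕ × ℕ × ℕ) (o : ℕ) : List Bool :=
  if x.1 = 0 then (if o = x.2.1 then [false] else []) else
  if x.1 = 1 then (if o = x.2.1 then [true] else if o = x.2.2 then [false] else []) else
  if o = p then [] else [false]

theorem PolyTime.colorList {α : Type} [Enc α] {p o : α → ℕ} {x : α → ℕ × ℕ × ℕ}
    (hp : PolyTime p) (hx : PolyTime x) (ho : PolyTime o) :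
    PolyTime fun z => colorList (p z) (x z) (o z) := by
  unfold VoteControl.colorList
  fun_prop

/-- The parsed data of an instance of control. -/
abbrev ControlData :=
  List (List Bool) × List Bool × List Bool × List (List (List Bool)) × List (List (List Bool))

/-- The first and the last candidate of a vote. -/
def voteEnds (cands : List (List Bool)) (v : List (List Bool)) : ℕ × ℕ :=
  (cands.idxOf (v.headD []), cands.idxOf (v.tail.reverse.headD [true]))

theorem PolyTime.voteEnds {α : Type} [Enc α] {c v : α → List (List Bool)}
    (hc : PolyTime c) (hv : PolyTime v) : PolyTime fun z => voteEnds (c z) (v z) := by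
  unfold VoteControl.voteEnds
  fun_prop

attribute [fun_prop] PolyTime.colorList PolyTime.voteEnds

/-- The types of the left vertices with the ends of their votes. -/
def leftVertices (z : ControlData) (s : ℕ) : List (ℕ × ℕ × ℕ) :=
  z.2.2.2.1.map (fun v => (0, voteEnds z.1 v)) ++
    (z.2.2.2.2.map (fun v => (1, voteEnds z.1 v)) ++
      (List.range (z.1.length + 1)).flatMap fun _ => List.replicate s (2, (0, 0)))

/-- The candidates of the right vertices. -/
def rightVertices (z : ControlData) (s : ℕ) : List ℕ :=
  z.2.2.2.1.map (fun v => (voteEnds z.1 v).2) ++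
    (z.2.2.2.2.map (fun v => (voteEnds z.1 v).2) ++
      (List.range (z.1.length + 1)).flatMap fun c => List.replicate s c)

abbrev ColoredGraphData := List ℕ × List ℕ × List Bool × List (ℕ × ℕ × Bool)

def ColoredGraphData.encode (z : ColoredGraphData) : List Γ' :=
  encodeList Code.nat.encode z.1 ++ (encodeList Code.nat.encode z.2.1 ++
    (z.2.2.1.map Γ'.bit ++ [Γ'.comma] ++
      encodeList (fun e : ℕ × ℕ × Bool =>
        Code.nat.encode e.1 ++ (Code.nat.encode e.2.1 ++ [Γ'.bit e.2.2])) z.2.2.2))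

theorem PolyTime.coloredGraphData_encode : PolyTime ColoredGraphData.encode := by
  unfold ColoredGraphData.encode
  have h := PolyTime.encodeBits (l := fun z : ColoredGraphData => z.2.2.1) (by fun_prop)
  have hb := PolyTime.of_bool Γ'.bit
  fun_prop

/-- Both sides of the graph are enumerated by the same list of vertices, so the length of `O` serves
for both. -/
def coloredEdges (p : ℕ) (A : List (ℕ × ℕ × ℕ)) (O : List ℕ) : List (ℕ × ℕ × Bool) :=
  (List.range O.length).flatMap fun i => (List.range O.length).flatMap fun j =>
    (colorList p (A.getD i (0, 0, 0)) (O.getD j 0)).map fun b => (i, j, b)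

@[fun_prop]
theorem PolyTime.coloredEdges {α : Type} [Enc α] {p : α → ℕ} {A : α → List (ℕ × ℕ × ℕ)}
    {O : α → List ℕ} (hp : PolyTime p) (hA : PolyTime A) (hO : PolyTime O) :
    PolyTime fun z => coloredEdges (p z) (A z) (O z) := by
  unfold VoteControl.coloredEdges
  fun_prop

@[fun_prop]
theorem PolyTime.leftVertices {α : Type} [Enc α] {z : α → ControlData} {s : α → ℕ}
    (hz : PolyTime z) (hs : PolyTime s) : PolyTime fun x => leftVertices (z x) (s x) := by
  unfold VoteControl.leftVertices
  fun_prop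

@[fun_prop]
theorem PolyTime.rightVertices {α : Type} [Enc α] {z : α → ControlData} {s : α → ℕ}
    (hz : PolyTime z) (hs : PolyTime s) : PolyTime fun x => rightVertices (z x) (s x) := by
  unfold VoteControl.rightVertices
  fun_prop

def graphOfElection (z : ControlData) (s : ℕ) : ColoredGraphData :=
  (List.range (rightVertices z s).length, List.range (rightVertices z s).length, z.2.2.1,
    coloredEdges (z.1.idxOf z.2.1) (leftVertices z s) (rightVertices z s))

def graphsOfElection (z : ControlData) : List ColoredGraphData :=
  (List.range (z.2.2.2.1.length + z.2.2.2.2.length + 1)).map fun s => graphOfElection z s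

theorem PolyTime.graphsOfElection : PolyTime graphsOfElection := by
  unfold VoteControl.graphsOfElection VoteControl.graphOfElection
  fun_prop

namespace AddingVotersInstance

variable (I : AddingVotersInstance)

def controlData : ControlData :=
  ((List.range I.m).map encodeNat, encodeNat I.p, encodeNat I.k,
    I.registered.map fun v => v.toList.map encodeNat,
    I.unregistered.map fun v => v.toList.map encodeNat)

theorem parsable : Parsable AddingVotersInstance.code controlData := by
  have h := ((Parsable.nat.list.pair (Parsable.nat.pair (Parsable.nat.pair
    (Parsable.nat.list.list.pair Parsable.nat.list.list)))).comap
      AddingVotersInstance.toData AddingVotersInstance.toData_injective)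
  refine (congrArg (Parsable _) (funext fun I => ?_)).mpr h
  simp [controlData, toData, List.map_map, Function.comp_def]

theorem voteEnds_toList (v : Vote I.m) : voteEnds I.controlData.1 (v.toList.map encodeNat) =
    ((I.firstOf v : ℕ), (I.lastOf v : ℕ)) := by
  have hm := I.p.pos
  have hv : ∀ i : Fin I.m, (v.toList.map encodeNat)[(i : ℕ)]? = some (encodeNat (v i)) := by
    intro i
    simp [Vote.toList]
  have hl : (v.toList.map encodeNat).length = I.m := by simp [Vote.toList]
  refine Prod.ext ?_ ?_
  · have : (v.toList.map encodeNat).headD [] = encodeNat (v ⟨0, hm⟩) := by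
      rw [List.headD_eq_head?_getD, List.head?_eq_getElem?, hv ⟨0, hm⟩]
      rfl
    simp only [voteEnds, this]
    exact idxOf_encodeNat (v _).2
  · simp only [voteEnds, List.headD_eq_head?_getD, List.head?_reverse, List.getLast?_tail, hl,
      lastOf]
    split_ifs with h
    -- With one candidate the tail of the vote is empty. The default `[true]` differs from the only
    -- name `[]`, so its index is the length 1 of the list, which is the additional candidate.
    · simp [controlData, h, encodeNat_zero]
    · rw [List.getLast?_eq_getElem?, hl, hv ⟨I.m - 1, Nat.sub_lt hm one_pos⟩]
      exact idxOf_encodeNat (v _).2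

theorem vertices_map {β : Type} (s : ℕ) (f : I.Vertex s → β) : (I.vertices s).map f =
    (List.finRange I.registered.length).map (fun i => f (.inl (.inl i))) ++
    ((List.finRange I.unregistered.length).map (fun i => f (.inl (.inr i))) ++
      (List.finRange (I.m + 1)).flatMap fun c =>
        (List.finRange s).map fun i => f (.inr (c, i))) := by
  simp [vertices, List.map_flatMap, Function.comp_def]

theorem map_finRange_getElem {β γ : Type} (l : List β) (f : β → γ) :
    (List.finRange l.length).map (fun i => f l[i]) = l.map f :=
  List.ext_getElem (by simp) (by simp)

/-- The type of a left vertex with the ends of the vote. -/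
def kind (s : ℕ) : I.Vertex s → ℕ × ℕ × ℕ
  | .inl (.inl i) => (0, I.first (.inl i), I.last (.inl i))
  | .inl (.inr i) => (1, I.first (.inr i), I.last (.inr i))
  | .inr _ => (2, (0, 0))

theorem leftVertices_controlData (s : ℕ) :
    leftVertices I.controlData s = (I.vertices s).map (I.kind s) := by
  have hv : ∀ (t : ℕ) (V : List (Vote I.m)), (V.map fun v => v.toList.map encodeNat).map
      (fun v => (t, voteEnds I.controlData.1 v)) =
      (List.finRange V.length).map fun i => (t, (I.firstOf V[i] : ℕ), (I.lastOf V[i] : ℕ)) := by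
    intro t V
    rw [map_finRange_getElem V fun v => (t, (I.firstOf v : ℕ), (I.lastOf v : ℕ)), List.map_map]
    exact List.map_congr_left fun v _ => by simp [voteEnds_toList]
  have hm : I.controlData.1.length = I.m := by simp [controlData]
  rw [vertices_map, leftVertices, hm, ← flatMap_finRange_val]
  refine congr_arg₂ _ (hv 0 I.registered) (congr_arg₂ _ (hv 1 I.unregistered) ?_)
  simp [kind]

theorem rightVertices_controlData (s : ℕ) : rightVertices I.controlData s =
    (I.vertices s).map fun y => ((Flow.owner I.last s y : Fin (I.m + 1)) : ℕ) := by
  have hv : ∀ V : List (Vote I.m), (V.map fun v => v.toList.map encodeNat).map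
      (fun v => (voteEnds I.controlData.1 v).2) =
      (List.finRange V.length).map fun i => (I.lastOf V[i] : ℕ) := by
    intro V
    rw [map_finRange_getElem V fun v => (I.lastOf v : ℕ), List.map_map]
    exact List.map_congr_left fun v _ => by simp [voteEnds_toList]
  have hm : I.controlData.1.length = I.m := by simp [controlData]
  rw [vertices_map, rightVertices, hm, ← flatMap_finRange_val]
  refine congr_arg₂ _ (hv I.registered) (congr_arg₂ _ (hv I.unregistered) ?_)
  simp [Flow.owner]

theorem colorList_kind (s : ℕ) (x : I.Vertex s) (o : Fin (I.m + 1)) :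
    colorList I.p (I.kind s x) o =
      (Flow.color I.first I.last I.p.castSucc s x o).toList := by
  rcases x with (i | i) | d <;> simp only [colorList, kind, Flow.color, Fin.ext_iff,
    Fin.val_castSucc, apply_ite Option.toList] <;> rfl

/-- Codes depend on the order of the edges; both lists run through the pairs of positions in the
same order. -/
theorem coloredEdges_controlData (s : ℕ) :
    coloredEdges I.p (leftVertices I.controlData s) (rightVertices I.controlData s) =
      (I.toGraph s).edgeList.map fun e => ((e.1 : ℕ), (e.2.1 : ℕ), e.2.2) := by
  simp only [toGraph, RedBipartiteInstance.colorEdges, List.map_flatMap, List.map_map,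
    coloredEdges, rightVertices_controlData, leftVertices_controlData, List.length_map,
    ← flatMap_finRange_val]
  refine List.flatMap_congr fun i _ => List.flatMap_congr fun j _ => ?_
  rw [getElem_of_getD (by simp), getElem_of_getD (by simp), List.getElem_map, List.getElem_map,
    colorList_kind]
  rfl

theorem encode_toGraph (s : ℕ) : RedBipartiteInstance.code.encode (I.toGraph s) =
    (graphOfElection I.controlData s).encode := by
  have hp : I.controlData.1.idxOf I.controlData.2.1 = I.p := idxOf_encodeNat I.p.2
  have hL : (rightVertices I.controlData s).length = (I.vertices s).length := by
    simp [rightVertices_controlData]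
  simp only [graphOfElection, ColoredGraphData.encode, hp, hL, coloredEdges_controlData]
  rfl

end AddingVotersInstance

theorem control_reducible_matching :
    PolyTimeDTTReducible (exactCCAV firstLast) exactPerfectBipartiteMatching := by
  refine dttReducible_of_polyTime AddingVotersInstance.parsable ColoredGraphData.encode
    PolyTime.coloredGraphData_encode graphsOfElection PolyTime.graphsOfElection
    AddingVotersInstance.toGraphs (fun I => ?_) AddingVotersInstance.isYes_iff_exists_toGraphs
  have hV : I.controlData.2.2.2.1.length = I.registered.length := by
    simp [AddingVotersInstance.controlData]
  have hW : I.controlData.2.2.2.2.length = I.unregistered.length := by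
    simp [AddingVotersInstance.controlData]
  simp only [AddingVotersInstance.toGraphs, graphsOfElection, hV, hW]
  rw [List.map_map]
  refine List.map_map.trans ?_
  exact List.map_congr_left fun s _ => I.encode_toGraph s

end VoteControl

theorem mainTheorem3 :
    VoteControl.PolyTimeDTTEquivalent
      (VoteControl.exactCCAV VoteControl.firstLast)
      VoteControl.exactPerfectBipartiteMatching :=
  ⟨VoteControl.control_reducible_matching, VoteControl.matching_reducible_control⟩
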